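/- **Theorem A.** For integers $1\le k<n$ write $\sigma_{d-1}=2\pi^{d/2}/\Gamma(d/2)$ for the area of the unit sphere in $\mathbb R^d$, and let $\psi$ be the indicator function of $[0,1]$ on $[0,\infty)$. Consider the Abel-type equation $$c\,r^{2-n}\int_0^r s^{n-k-1}w(s)\,(r^2-s^2)^{k/2-1}\,ds=\psi(r),\qquad r>0,\qquad c=\frac{\sigma_{k-1}\sigma_{n-k-1}}{\sigma_{n-1}},\tag{1}$$ where a solution $w$ is understood to make the integral absolutely convergent. (i) Let $k=1$, $n\ge2$. The function $$w(r)=1\quad(0\le r\le 1),\qquad w(r)=-\frac{\Gamma(\frac{n-1}2)\,r^{3-n}}{2\sqrt\pi\,\Gamma(\frac n2)}\int_0^1 v^{n/2-1}(r^2-v)^{-3/2}\,dv\quad(r>1)$$ is locally integrable on $[0,\infty)$ and satisfies (1) for every $r>0$. For $n=2$ it equals Nievergelt's function, that is $w(r)=1-r/\sqrt{r^2-1}$ for $r>1$. Let $\mathcal G_{n,1}$ be the set of all lines $\tau=\zeta+x''$ in $\mathbb R^n$ ($\zeta$ a one-dimensional subspace, $x''\in\zeta^\perp$) with the measure $d\tau=d\zeta\,dx''$,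 where $d\zeta$ is the rotation-invariant measure of total mass $1$ and $dx''$ is the volume on $\zeta^\perp$; let $\hat f(\tau)=\int_\zeta f(x'+x'')\,dx'$ be the X-ray transform and $$(W_a^*\varphi)(x)=\frac1{a^n}\int_{\mathcal G_{n,1}}\varphi(\tau)\,w\!\left(\frac{|x-\tau|}{a}\right)d\tau,\qquad a>0,$$ where $|x-\tau|$ is the distance from $x$ to $\tau$. If $f\in L^p(\mathbb R^n)$, $1\le p<n$, then $\hat f(\tau)$ is an absolutely convergent integral for almost every line $\tau$; for all $a>0$ and $x\in\mathbb R^n$ the integral $(W_a^*\hat f)(x)$ converges absolutely and $$(W_a^*\hat f)(x)=\int_{\mathbb R^n}f(x-ay)\,\psi(|y|)\,dy;$$ $W_a^*\hat f\in L^p(\mathbb R^n)$; and $$\lim_{a\to0^+}(W_a^*\hat f)(x)=\lambda f(x),\qquad \lambda=\int_{\mathbb R^n}\psi(|x|)\,dx,$$ both in the $L^p$-norm and for almost every $x$. If in addition $f$ is continuous and vanishes at infinity, the limit is uniform on $\mathbb R^n$. (ii) Let $1<k<n$. Then there is no function $w$ on $(0,\infty)$ for which, for almost every $r>0$, the integral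 in (1) converges absolutely and (1) holds. In particular (1) has no locally integrable solution, and Nievergelt's method does not apply. -/

import Mathlib

open MeasureTheory Set Filter Topology
open scoped ENNReal

noncomputable section

/-- Euclidean space `ℝⁿ`. -/
abbrev Euc (n : ℕ) : Type := EuclideanSpace ℝ (Fin n)

/-! ### Lines in `ℝⁿ` and the measure on them -/

/-- The Grassmannian `G_{n,1}` of one-dimensional linear subspaces `ζ` of `ℝⁿ`. -/
def LineDir (n : ℕ) : Type := {ζ : Submodule ℝ (Euc n) // Module.finrank ℝ ζ = 1}

/-- The subspace spanned by a unit vector. -/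
def dirOfUnit (n : ℕ) (θ : Metric.sphere (0 : Euc n) 1) : LineDir n :=
  ⟨Submodule.span ℝ {(θ : Euc n)},
    finrank_span_singleton (ne_zero_of_mem_unit_sphere θ)⟩

/-- `G_{n,1}` is the quotient of the unit sphere by `θ ∼ -θ`; it carries the quotient
σ-algebra. -/
instance instMeasurableSpaceLineDir (n : ℕ) : MeasurableSpace (LineDir n) :=
  MeasurableSpace.map (dirOfUnit n) inferInstance

/-- The rotation invariant measure `dζ` of total mass one on `G_{n,1}`: the image of the
normalized surface measure of the unit sphere. -/
def dirMeasure (n : ℕ) : Measure (LineDir n) :=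
  Measure.map (dirOfUnit n)
    (((volume : Measure (Euc n)).toSphere univ)⁻¹ • (volume : Measure (Euc n)).toSphere)

/-- The affine Grassmannian of all non-oriented lines in `ℝⁿ`; the pair
`(ζ, x'')` with `x'' ∈ ζᗮ` stands for the line `ζ + x''`. -/
def Line (n : ℕ) : Type := Σ ζ : LineDir n, (ζ.1ᗮ : Submodule ℝ (Euc n))

/-- The line `ζ + x''` as a set of points. -/
def Line.points {n : ℕ} (τ : Line n) : Set (Euc n) :=
  {x | ∃ x' : τ.1.1, x = (x' : Euc n) + (τ.2 : Euc n)}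

/-- The integral over all lines with respect to `dτ = dζ dx''`, where `dx''` is the volume
on `ζᗮ`. -/
def lineIntegral {n : ℕ} {F : Type*} [NormedAddCommGroup F] [NormedSpace ℝ F]
    (Φ : Line n → F) : F :=
  ∫ ζ : LineDir n, (∫ u : (ζ.1ᗮ : Submodule ℝ (Euc n)), Φ ⟨ζ, u⟩) ∂(dirMeasure n)

/-- Absolute convergence of the integral of `Φ` over all lines. -/
def LineIntegrable {n : ℕ} {F : Type*} [NormedAddCommGroup F] (Φ : Line n → F) : Prop :=
  (∀ᵐ ζ ∂(dirMeasure n),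
      Integrable (fun u : (ζ.1ᗮ : Submodule ℝ (Euc n)) => Φ ⟨ζ, u⟩) volume) ∧
    Integrable
      (fun ζ : LineDir n => ∫ u : (ζ.1ᗮ : Submodule ℝ (Euc n)), ‖Φ ⟨ζ, u⟩‖) (dirMeasure n)

/-- A property holds for almost every line (with respect to `dζ dx''`). -/
def AlmostEveryLine {n : ℕ} (P : Line n → Prop) : Prop :=
  ∀ᵐ ζ ∂(dirMeasure n), ∀ᵐ u : (ζ.1ᗮ : Submodule ℝ (Euc n)), P ⟨ζ, u⟩

/-! ### The X-ray transform and the wavelet-like backprojection -/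

/-- The X-ray transform `f̂(ζ, x'') = ∫_ζ f(x' + x'') dx'`. -/
def xray {n : ℕ} {F : Type*} [NormedAddCommGroup F] [NormedSpace ℝ F]
    (f : Euc n → F) (τ : Line n) : F :=
  ∫ x' : τ.1.1, f ((x' : Euc n) + (τ.2 : Euc n))

/-- `f` is absolutely integrable along the line `τ`, so that `f̂(τ)` is defined. -/
def XrayDefinedAt {n : ℕ} {F : Type*} [NormedAddCommGroup F]
    (f : Euc n → F) (τ : Line n) : Prop :=
  Integrable (fun x' : τ.1.1 => f ((x' : Euc n) + (τ.2 : Euc n))) volume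

/-- The integrand `τ ↦ w(|x - τ| / a) φ(τ)` of the wavelet-like transform. -/
def waveletIntegrand {n : ℕ} {F : Type*} [NormedAddCommGroup F] [NormedSpace ℝ F]
    (w : ℝ → ℝ) (a : ℝ) (φ : Line n → F) (x : Euc n) (τ : Line n) : F :=
  w (Metric.infDist x τ.points / a) • φ τ

/-- The wavelet-like transform `(W*_a φ)(x) = a^{-n} ∫ φ(τ) w(|x - τ| / a) dτ`. -/
def waveletTransform {n : ℕ} {F : Type*} [NormedAddCommGroup F] [NormedSpace ℝ F]
    (w : ℝ → ℝ) (a : ℝ) (φ : Line n → F) (x : Euc n) : F :=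
  (a ^ n)⁻¹ • lineIntegral (waveletIntegrand w a φ x)

/-! ### The Abel type integral equation -/

/-- The area `2 π^{d/2} / Γ(d/2)` of the unit sphere of `ℝᵈ`. -/
def unitSphereArea (d : ℝ) : ℝ := 2 * Real.pi ^ (d / 2) / Real.Gamma (d / 2)

/-- The constant `c = σ_{k-1} σ_{n-k-1} / σ_{n-1}`. -/
def abelConst (n k : ℕ) : ℝ :=
  unitSphereArea (k : ℝ) * unitSphereArea ((n : ℝ) - k) / unitSphereArea (n : ℝ)

/-- The integrand `s^{n-k-1} w(s) (r² - s²)^{k/2-1}`. -/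
def abelIntegrand (n k : ℕ) (w : ℝ → ℝ) (r s : ℝ) : ℝ :=
  s ^ ((n : ℝ) - k - 1) * w s * (r ^ 2 - s ^ 2) ^ ((k : ℝ) / 2 - 1)

/-- `w` satisfies, at the point `r`, the equation
`c r^{2-n} ∫₀ʳ s^{n-k-1} w(s) (r² - s²)^{k/2-1} ds = ψ(r)`,
the integral being absolutely convergent. -/
def AbelEquationAt (n k : ℕ) (ψ w : ℝ → ℝ) (r : ℝ) : Prop :=
  IntegrableOn (abelIntegrand n k w r) (Ioo 0 r) volume ∧
    abelConst n k * r ^ (2 - (n : ℝ)) * (∫ s in Ioo 0 r, abelIntegrand n k w r s) = ψ r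

/-- Nievergelt's choice of `ψ` on `[0, ∞)`: the indicator function of `[0, 1]`. -/
def nievergeltPsi (r : ℝ) : ℝ := (Icc (0 : ℝ) 1).indicator (fun _ => 1) r

/-- The function `w` for the X-ray transform in dimension `n` (used for arguments `r ≥ 0`). -/
def xrayW (n : ℕ) (r : ℝ) : ℝ :=
  if r ≤ 1 then 1
  else
    -(Real.Gamma (((n : ℝ) - 1) / 2) * r ^ (3 - (n : ℝ)) /
        (2 * Real.sqrt Real.pi * Real.Gamma ((n : ℝ) / 2))) *
      ∫ v in (0 : ℝ)..1, v ^ ((n : ℝ) / 2 - 1) * (r ^ 2 - v) ^ (-(3 / 2) : ℝ)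

/-- Nievergelt's function in the plane. -/
def nievergeltW (r : ℝ) : ℝ :=
  if r ≤ 1 then 1 else 1 - r / Real.sqrt (r ^ 2 - 1)

/-- `λ = ∫_{ℝⁿ} ψ(|x|) dx` for Nievergelt's `ψ`. -/
def nievergeltLambda (n : ℕ) : ℝ := ∫ x : Euc n, nievergeltPsi ‖x‖

end

/-! Write `n = m + 2`. Unfolding `xray` over `ζᗮ` and interchanging integrals turns the wavelet-like
transform into `a⁻ⁿ ∫ f(y) A((x - y)/a) dy`, where `A(z)` is the mean over directions `θ` of `w(|P
z|)`, with `P` the projection onto the complement of `θ`. For `|z| = ρ` the length `|P z|` has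
density `c ρ⁻ᵐ sᵐ (ρ² - s²)^{-1/2}` on `(0, ρ)` (`lintegral_sphereProb_perp`), so `A(z)` is the left
side of the Abel equation at `ρ`, that is `ψ(ρ)` (`integral_sphereProb_xrayW`). The transform is
therefore a plain ball mean of `f`, and the limits are the classical ones: continuity of
translations in `Lᵖ`, Lebesgue differentiation, uniform continuity.

The Abel equation for `r ≤ 1` is a beta integral. For `r > 1` the contribution of `(1, r)` must
cancel that of `(0, 1)`. The former has constant sign, so Tonelli applies freely: an elementary
integral, a beta integral for `vᵐ⸍²` and an arcsine integral turn one into the other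
(`lintegral_tail`). The constant sign also gives the mean of `|w|` as twice the head, hence a bound
by a multiple of `(1 + ρ)^{-(n-1)}` (`lintegral_sphereProb_enorm_xrayW_le`). For `p < n` this decay
lies in the dual exponent of `Lᵖ`, so Hölder's inequality justifies Fubini's theorem and every
convergence claim (`lintegral_decay_lt_top`).

For `k > 1` the kernel exponent `k/2 - 1` is nonnegative. The left side of the Abel equation is then
continuous at `r = 1`, while `ψ` jumps there (`not_exists_abel_solution`). -/

/-! ### One-dimensional kernel integrals -/

/-- The value of `∫₀¹ sᵐ (1 - s²)^{-1/2} ds`. -/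
noncomputable def betaHalf (m : ℕ) : ℝ :=
  ProbabilityTheory.beta (((m : ℝ) + 1) / 2) (1 / 2) / 2

lemma betaHalf_pos (m : ℕ) : 0 < betaHalf m :=
  half_pos (ProbabilityTheory.beta_pos (by positivity) (by norm_num))

/-- A nonnegative derivative is automatically integrable up to the endpoints, so inverse square root
singularities there need no separate treatment. -/
lemma lintegral_deriv_of_nonneg {F f : ℝ → ℝ} {a b : ℝ} (hab : a ≤ b)
    (hc : ContinuousOn F (Icc a b)) (hd : ∀ x ∈ Ioo a b, HasDerivAt F (f x) x)
    (hf : ∀ x ∈ Ioo a b, 0 ≤ f x) :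
    ∫⁻ x in Ioo a b, ENNReal.ofReal (f x) = ENNReal.ofReal (F b - F a) := by
  have hi : IntegrableOn f (Ioc a b) := intervalIntegral.integrableOn_deriv_of_nonneg hc hd hf
  have h := intervalIntegral.integral_eq_sub_of_hasDerivAt_of_le hab hc hd
    ((intervalIntegrable_iff_integrableOn_Ioc_of_le hab).2 hi)
  rw [← h, intervalIntegral.integral_of_le hab, integral_Ioc_eq_integral_Ioo]
  rw [ofReal_integral_eq_lintegral_ofReal (hi.mono_set Ioo_subset_Ioc_self)]
  filter_upwards [ae_restrict_mem measurableSet_Ioo] with x hx using hf x hx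

/-- The substitution `s = r √v` produces the beta density with parameters `(m+1)/2` and `1/2`, whose
total mass is one. -/
lemma lintegral_pow_mul_inv_sqrt (m : ℕ) {r : ℝ} (hr : 0 < r) :
    ∫⁻ s in Ioo 0 r, ENNReal.ofReal (s ^ m * (√(r ^ 2 - s ^ 2))⁻¹) =
      ENNReal.ofReal (r ^ m * betaHalf m) := by
  have himg : (fun v : ℝ => r * √v) '' Ioo 0 1 = Ioo 0 r := by
    ext s
    constructor
    · rintro ⟨v, ⟨h0, h1⟩, rfl⟩
      have : √v < 1 := by rw [Real.sqrt_lt' one_pos]; simpa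
      have := Real.sqrt_pos.2 h0
      exact ⟨by positivity, by nlinarith⟩
    · rintro ⟨h0, h1⟩
      refine ⟨(s / r) ^ 2, ⟨by positivity, ?_⟩, ?_⟩
      · have : s / r < 1 := (div_lt_one hr).2 h1
        have h2 : 0 < s / r := by positivity
        nlinarith
      · simp only
        rw [Real.sqrt_sq (by positivity)]
        field_simp
  have hinj : InjOn (fun v : ℝ => r * √v) (Ioo 0 1) := by
    intro v hv u hu h
    have : √v = √u := by simpa [hr.ne'] using h
    exact (Real.sqrt_inj hv.1.le hu.1.le).1 this
  have hder : ∀ v ∈ Ioo (0 : ℝ) 1, HasDerivWithinAt (fun v : ℝ => r * √v)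
      (r * (1 / (2 * √v))) (Ioo 0 1) v := fun v hv =>
    ((Real.hasDerivAt_sqrt hv.1.ne').const_mul r).hasDerivWithinAt
  rw [← himg, lintegral_image_eq_lintegral_abs_deriv_mul measurableSet_Ioo hder hinj]
  have h1 := ProbabilityTheory.lintegral_betaPDF_eq_one (α := ((m : ℝ) + 1) / 2) (β := 1 / 2)
    (by positivity) (by norm_num)
  rw [ProbabilityTheory.lintegral_betaPDF] at h1
  have hB : 0 < ProbabilityTheory.beta (((m : ℝ) + 1) / 2) (1 / 2) :=
    ProbabilityTheory.beta_pos (by positivity) (by norm_num)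
  rw [← mul_one (ENNReal.ofReal (r ^ m * betaHalf m)), ← h1,
    ← lintegral_const_mul' _ _ ENNReal.ofReal_ne_top]
  refine setLIntegral_congr_fun measurableSet_Ioo fun v hv => ?_
  have hv0 : 0 < v := hv.1
  have hv1 : 0 < 1 - v := by linarith [hv.2]
  have hsv : 0 < √v := Real.sqrt_pos.2 hv0
  rw [← ENNReal.ofReal_mul (by positivity),
    ← ENNReal.ofReal_mul (mul_nonneg (by positivity) (betaHalf_pos m).le)]
  congr 1
  have e1 : r ^ 2 - (r * √v) ^ 2 = r ^ 2 * (1 - v) := by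
    rw [mul_pow, Real.sq_sqrt hv0.le]; ring
  rw [e1, Real.sqrt_mul (by positivity), Real.sqrt_sq hr.le, abs_of_pos (by positivity), betaHalf]
  have e2 : v ^ (((m : ℝ) + 1) / 2 - 1) = √v ^ m / √v := by
    rw [show ((m : ℝ) + 1) / 2 - 1 = (1 / 2) * m - 1 / 2 by ring, Real.rpow_sub hv0,
      Real.rpow_mul hv0.le, ← Real.sqrt_eq_rpow, Real.rpow_natCast]
  have e3 : (1 - v) ^ ((1 : ℝ) / 2 - 1) = (√(1 - v))⁻¹ := by
    rw [show (1 : ℝ) / 2 - 1 = -(1 / 2) by norm_num, Real.rpow_neg hv1.le, ← Real.sqrt_eq_rpow]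
  rw [e2, e3]
  have := Real.sqrt_pos.2 hv1
  field_simp
  exact mul_pow _ _ _

/-- The integrand has an algebraic antiderivative, which vanishes at `s = r`; only the endpoint `s =
1` contributes. -/
lemma lintegral_tail_kernel {v r : ℝ} (hv : v < 1) (hr : 1 < r) :
    ∫⁻ s in Ioo 1 r, ENNReal.ofReal (s * (√(s ^ 2 - v) ^ 3)⁻¹ * (√(r ^ 2 - s ^ 2))⁻¹) =
      ENNReal.ofReal ((r ^ 2 - v)⁻¹ * (√(r ^ 2 - 1) * (√(1 - v))⁻¹)) := by
  have hR : 0 < r ^ 2 - v := by nlinarith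
  rw [lintegral_deriv_of_nonneg (F := fun s => -((r ^ 2 - v)⁻¹ * (√(r ^ 2 - s ^ 2) * (√(s ^ 2 - v))⁻¹)))
    hr.le]
  · simp
  · refine ContinuousOn.neg (continuousOn_const.mul (ContinuousOn.mul (by fun_prop)
      (ContinuousOn.inv₀ (by fun_prop) fun s hs => ?_)))
    have : 0 < s ^ 2 - v := by nlinarith [hs.1]
    exact (Real.sqrt_pos.2 this).ne'
  · intro s hs
    have h1 : 0 < s ^ 2 - v := by nlinarith [hs.1]
    have h2 : 0 < r ^ 2 - s ^ 2 := by nlinarith [hs.1, hs.2]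
    have q1 := Real.sqrt_pos.2 h1
    have q2 := Real.sqrt_pos.2 h2
    have hp : HasDerivAt (fun s : ℝ => s ^ 2) (2 * s) s := by simpa using hasDerivAt_pow 2 s
    have d1 := (hp.const_sub (r ^ 2)).sqrt h2.ne'
    have d2 := ((hp.sub_const v).sqrt h1.ne').inv q1.ne'
    refine (((d1.mul d2).const_mul _).neg).congr_deriv ?_
    have s1 := Real.sq_sqrt h1.le
    have s2 := Real.sq_sqrt h2.le
    simp only [Pi.inv_apply]
    generalize √(s ^ 2 - v) = A at *
    generalize √(r ^ 2 - s ^ 2) = B at *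
    have e : r ^ 2 - v = A ^ 2 + B ^ 2 := by rw [s1, s2]; ring
    have : 0 < A ^ 2 + B ^ 2 := by positivity
    rw [e]
    field_simp
    ring
  · intro s hs
    have : 0 < s := by linarith [hs.1]
    positivity

/-- The substitution is `u² = (R-1)(v-t) / ((R-v)(1-t))`, a Möbius map in `v` fixing the range `(0,
1)`: `t` goes to `0` and `1` to `1`. Then `1 - u² = (R-t)(1-v) / ((R-v)(1-t))`, and the integrand
becomes a multiple of the derivative of `arcsin u`. -/
lemma lintegral_arcsin_kernel {t R : ℝ} (ht : t < 1) (hR : 1 < R) :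
    ∫⁻ v in Ioo t 1, ENNReal.ofReal ((√(v - t))⁻¹ * (√(1 - v))⁻¹ * (R - v)⁻¹) =
      ENNReal.ofReal (Real.pi * (√(R - t))⁻¹ * (√(R - 1))⁻¹) := by
  have hR1 : 0 < R - 1 := by linarith
  have hRt : 0 < R - t := by linarith
  have ht1 : 0 < 1 - t := by linarith
  have qR1 := Real.sqrt_pos.2 hR1
  have qRt := Real.sqrt_pos.2 hRt
  have qt1 := Real.sqrt_pos.2 ht1
  rw [lintegral_deriv_of_nonneg (F := fun v => 2 * (√(R - t))⁻¹ * (√(R - 1))⁻¹ *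
    Real.arcsin (√(R - 1) * √(v - t) * (√(R - v))⁻¹ * (√(1 - t))⁻¹)) ht.le]
  · simp only [sub_self, Real.sqrt_zero, mul_zero, zero_mul, Real.arcsin_zero, sub_zero]
    rw [show √(R - 1) * √(1 - t) * (√(R - 1))⁻¹ * (√(1 - t))⁻¹ = 1 by field_simp, Real.arcsin_one]
    congr 1
    ring
  · refine continuousOn_const.mul (Real.continuous_arcsin.comp_continuousOn ?_)
    refine ContinuousOn.mul (ContinuousOn.mul (by fun_prop)
      (ContinuousOn.inv₀ (by fun_prop) fun s hs => ?_)) continuousOn_const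
    have : 0 < R - s := by linarith [hs.2]
    exact (Real.sqrt_pos.2 this).ne'
  · intro v hv
    have h1 : 0 < v - t := by linarith [hv.1]
    have h2 : 0 < 1 - v := by linarith [hv.2]
    have h3 : 0 < R - v := by linarith
    have q1 := Real.sqrt_pos.2 h1
    have q2 := Real.sqrt_pos.2 h2
    have q3 := Real.sqrt_pos.2 h3
    have d1 := ((hasDerivAt_id v).sub_const t).sqrt h1.ne'
    have d3 := (((hasDerivAt_id v).const_sub R).sqrt h3.ne').inv q3.ne'
    have d := ((d1.const_mul (√(R - 1))).mul d3).mul_const (√(1 - t))⁻¹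
    set u := √(R - 1) * √(v - t) * (√(R - v))⁻¹ * (√(1 - t))⁻¹ with hu
    have s1 := Real.sq_sqrt h1.le
    have s2 := Real.sq_sqrt h2.le
    have s3 := Real.sq_sqrt h3.le
    have s4 := Real.sq_sqrt hR1.le
    have s5 := Real.sq_sqrt hRt.le
    have s6 := Real.sq_sqrt ht1.le
    have hu2 : 1 - u ^ 2 = (√(R - t) * √(1 - v) * (√(R - v))⁻¹ * (√(1 - t))⁻¹) ^ 2 := by
      rw [hu]
      simp only [mul_pow, inv_pow, s1, s2, s3, s4, s5, s6]
      field_simp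
      ring
    have hpos : 0 < √(R - t) * √(1 - v) * (√(R - v))⁻¹ * (√(1 - t))⁻¹ := by positivity
    have hupos : 0 < u := by positivity
    have hu1 : u < 1 := by nlinarith
    have da := (Real.hasDerivAt_arcsin (x := u) (by linarith) hu1.ne).comp v d
    refine (da.const_mul _).congr_deriv ?_
    rw [hu2, Real.sqrt_sq hpos.le]
    simp only [Pi.inv_apply, id]
    rw [← s3]
    have e1 : R - t = √(R - v) ^ 2 + √(v - t) ^ 2 := by rw [s1, s3]; ring
    have s5' : √(R - t) ^ 2 = √(R - v) ^ 2 + √(v - t) ^ 2 := by rw [s5, e1]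
    clear_value u
    clear e1 hu hu2 hpos da d d1 d3
    generalize √(R - t) = A at *
    generalize √(v - t) = B at *
    generalize √(1 - v) = C at *
    generalize √(R - 1) = D at *
    generalize hE : √(R - v) = E at *
    generalize √(1 - t) = G at *
    rw [s3, hE]
    field_simp
    rw [s5']
    linear_combination (-(E ^ 2 + B ^ 2)) * s3
  · intro v hv
    have h3 : 0 < R - v := by linarith [hv.2]
    positivity

/-! ### The tail of `xrayW` and its cancellation against the head -/

/-- The constant `Γ((m+1)/2) / (2 √π Γ(m/2+1))` of the tail of `xrayW (m + 2)`. -/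
noncomputable def tailConst (m : ℕ) : ℝ :=
  Real.Gamma (((m : ℝ) + 1) / 2) / (2 * √Real.pi * Real.Gamma ((m : ℝ) / 2 + 1))

lemma tailConst_pos (m : ℕ) : 0 < tailConst m := by
  have := Real.Gamma_pos_of_pos (s := ((m : ℝ) + 1) / 2) (by positivity)
  have := Real.Gamma_pos_of_pos (s := (m : ℝ) / 2 + 1) (by positivity)
  have := Real.pi_pos
  unfold tailConst
  positivity

/-- The factor `π` comes from the arcsine integral and `betaHalf m` from the beta integral; this
identity makes the tail match the head exactly. -/
lemma tailConst_mul_pi (m : ℕ) : tailConst m * Real.pi = betaHalf m := by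
  have := Real.Gamma_pos_of_pos (s := (m : ℝ) / 2 + 1) (by positivity)
  have h := Real.sqrt_pos.2 Real.pi_pos
  have h2 := Real.sq_sqrt Real.pi_pos.le
  rw [betaHalf, ProbabilityTheory.beta, Real.Gamma_one_half_eq, tailConst,
    show ((m : ℝ) + 1) / 2 + 1 / 2 = (m : ℝ) / 2 + 1 by ring]
  nth_rewrite 2 [← h2]
  field_simp

/-- The parameter integral in the tail of `xrayW (m + 2)`. -/
noncomputable def tailIntegral (m : ℕ) (s : ℝ) : ℝ :=
  ∫ v in Ioo (0 : ℝ) 1, √v ^ m * (√(s ^ 2 - v) ^ 3)⁻¹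

lemma measurable_tailIntegral (m : ℕ) : Measurable (tailIntegral m) := by
  refine (StronglyMeasurable.integral_prod_right (f := fun (s v : ℝ) =>
    √v ^ m * (√(s ^ 2 - v) ^ 3)⁻¹) ?_).measurable
  exact Measurable.stronglyMeasurable (by unfold Function.uncurry; fun_prop)

lemma tailIntegral_nonneg (m : ℕ) (s : ℝ) : 0 ≤ tailIntegral m s :=
  integral_nonneg fun _ => by positivity

lemma ofReal_tailIntegral (m : ℕ) {s : ℝ} (hs : 1 < s) :
    ENNReal.ofReal (tailIntegral m s) =
      ∫⁻ v in Ioo (0 : ℝ) 1, ENNReal.ofReal (√v ^ m * (√(s ^ 2 - v) ^ 3)⁻¹) := by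
  refine ofReal_integral_eq_lintegral_ofReal ?_ (Eventually.of_forall fun v => by positivity)
  refine (ContinuousOn.integrableOn_Icc ?_).mono_set Ioo_subset_Icc_self
  refine ContinuousOn.mul (by fun_prop) (ContinuousOn.inv₀ (by fun_prop) fun v hv => ?_)
  have : 0 < s ^ 2 - v := by nlinarith [hv.2]
  exact (pow_pos (Real.sqrt_pos.2 this) 3).ne'

lemma xrayW_of_le_one (n : ℕ) {s : ℝ} (hs : s ≤ 1) : xrayW n s = 1 := if_pos hs

/-- The weight `sᵐ` of the Abel integral clears the power `s^{3-n} = s^{1-m}`; what remains visibly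
has constant sign. -/
lemma pow_mul_xrayW (m : ℕ) {s : ℝ} (hs : 1 < s) :
    s ^ m * xrayW (m + 2) s = -(tailConst m * s * tailIntegral m s) := by
  have hs0 : 0 < s := by linarith
  have hint : ∫ v in (0 : ℝ)..1, v ^ (((m + 2 : ℕ) : ℝ) / 2 - 1) * (s ^ 2 - v) ^ (-(3 / 2) : ℝ) =
      tailIntegral m s := by
    rw [intervalIntegral.integral_of_le zero_le_one, integral_Ioc_eq_integral_Ioo, tailIntegral]
    refine setIntegral_congr_fun measurableSet_Ioo fun v hv => ?_
    have h2 : 0 < s ^ 2 - v := by nlinarith [hv.2]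
    have e1 : v ^ (((m + 2 : ℕ) : ℝ) / 2 - 1) = √v ^ m := by
      rw [show ((m + 2 : ℕ) : ℝ) / 2 - 1 = (1 / 2) * m by push_cast; ring,
        Real.rpow_mul hv.1.le, ← Real.sqrt_eq_rpow, Real.rpow_natCast]
    have e2 : (s ^ 2 - v) ^ (-(3 / 2) : ℝ) = (√(s ^ 2 - v) ^ 3)⁻¹ := by
      rw [Real.rpow_neg h2.le, show (3 / 2 : ℝ) = (1 / 2) * (3 : ℕ) by norm_num,
        Real.rpow_mul h2.le, ← Real.sqrt_eq_rpow, Real.rpow_natCast]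
    simp only [e1, e2]
  rw [xrayW, if_neg (not_le.2 hs), hint, tailConst,
    show (3 : ℝ) - ((m + 2 : ℕ) : ℝ) = 1 - m by push_cast; ring,
    show (((m + 2 : ℕ) : ℝ) - 1) / 2 = ((m : ℝ) + 1) / 2 by push_cast; ring,
    show ((m + 2 : ℕ) : ℝ) / 2 = (m : ℝ) / 2 + 1 by push_cast; ring,
    Real.rpow_sub hs0, Real.rpow_one, Real.rpow_natCast]
  have := pow_pos hs0 m
  field_simp

lemma measurable_xrayW (m : ℕ) : Measurable (xrayW (m + 2)) := by
  have h : xrayW (m + 2) = fun s =>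
      if s ≤ 1 then 1 else -(tailConst m * s * tailIntegral m s) / s ^ m := by
    ext s
    split_ifs with hs
    · exact if_pos hs
    · have hs' := not_le.1 hs
      have : (0 : ℝ) < s ^ m := pow_pos (by linarith) m
      rw [← pow_mul_xrayW m hs']
      field_simp
  rw [h]
  have := measurable_tailIntegral m
  exact Measurable.ite measurableSet_Iic measurable_const (by fun_prop)

lemma lintegral_triangle_swap {f : ℝ → ℝ → ℝ≥0∞} (hf : Measurable (Function.uncurry f)) :
    ∫⁻ v in Ioo (0 : ℝ) 1, ∫⁻ s in Ioo 0 √v, f v s =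
      ∫⁻ s in Ioo (0 : ℝ) 1, ∫⁻ v in Ioo (s ^ 2) 1, f v s := by
  set T : Set (ℝ × ℝ) := {q | 0 < q.2 ∧ q.2 ^ 2 < q.1 ∧ q.1 < 1} with hT
  have hTm : MeasurableSet T := by
    have h1 : MeasurableSet {q : ℝ × ℝ | 0 < q.2} := measurableSet_lt (by fun_prop) (by fun_prop)
    have h2 : MeasurableSet {q : ℝ × ℝ | q.2 ^ 2 < q.1} :=
      measurableSet_lt (by fun_prop) (by fun_prop)
    have h3 : MeasurableSet {q : ℝ × ℝ | q.1 < 1} := measurableSet_lt (by fun_prop) (by fun_prop)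
    exact h1.inter (h2.inter h3)
  have h1 : ∀ v, (Ioo (0 : ℝ) 1).indicator (fun v => ∫⁻ s in Ioo 0 √v, f v s) v =
      ∫⁻ s, T.indicator (Function.uncurry f) (v, s) := by
    intro v
    by_cases hv : v ∈ Ioo (0 : ℝ) 1
    · rw [indicator_of_mem hv, ← lintegral_indicator measurableSet_Ioo]
      congr 1 with s
      by_cases hs : s ∈ Ioo 0 √v
      · rw [indicator_of_mem hs, indicator_of_mem]
        · rfl
        · exact ⟨hs.1, (Real.lt_sqrt hs.1.le).1 hs.2, hv.2⟩
      · rw [indicator_of_notMem hs, indicator_of_notMem]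
        rintro ⟨a, b, c⟩
        exact hs ⟨a, (Real.lt_sqrt (le_of_lt a)).2 b⟩
    · rw [indicator_of_notMem hv]
      refine ((lintegral_congr fun s => indicator_of_notMem ?_ _).trans lintegral_zero).symm
      rintro ⟨a, b, c⟩
      exact hv ⟨lt_of_le_of_lt (sq_nonneg _) b, c⟩
  have h2 : ∀ s, (Ioo (0 : ℝ) 1).indicator (fun s => ∫⁻ v in Ioo (s ^ 2) 1, f v s) s =
      ∫⁻ v, T.indicator (Function.uncurry f) (v, s) := by
    intro s
    by_cases hs : s ∈ Ioo (0 : ℝ) 1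
    · rw [indicator_of_mem hs, ← lintegral_indicator measurableSet_Ioo]
      congr 1 with v
      by_cases hv : v ∈ Ioo (s ^ 2) 1
      · rw [indicator_of_mem hv, indicator_of_mem]
        · rfl
        · exact ⟨hs.1, hv.1, hv.2⟩
      · rw [indicator_of_notMem hv, indicator_of_notMem]
        rintro ⟨a, b, c⟩
        exact hv ⟨b, c⟩
    · rw [indicator_of_notMem hs]
      refine ((lintegral_congr fun v => indicator_of_notMem ?_ _).trans lintegral_zero).symm
      rintro ⟨a, b, c⟩
      exact hs ⟨a, by have a' : 0 < s := a; have b' : s ^ 2 < v := b; have c' : v < 1 := c; nlinarith⟩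
  rw [← lintegral_indicator measurableSet_Ioo, ← lintegral_indicator measurableSet_Ioo]
  simp_rw [h1, h2]
  exact lintegral_lintegral_swap (hf.indicator hTm).aemeasurable

/-- This is the cancellation behind the Abel equation for `r > 1`. Tonelli is used twice: integrate
the tail over `s` first, write `√v ^ m` as a beta integral over `(0, √v)`, then integrate over `v`
first, which returns the kernel `(r² - s²)^{-1/2}`. -/
lemma lintegral_tail (m : ℕ) {r : ℝ} (hr : 1 < r) :
    ∫⁻ s in Ioo 1 r, ENNReal.ofReal
        (tailConst m * s * tailIntegral m s * (√(r ^ 2 - s ^ 2))⁻¹) =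
      ∫⁻ s in Ioo 0 1, ENNReal.ofReal (s ^ m * (√(r ^ 2 - s ^ 2))⁻¹) := by
  have hK := tailConst_pos m
  have hB := betaHalf_pos m
  have hKB := tailConst_mul_pi m
  have hr1 : 0 < r ^ 2 - 1 := by nlinarith
  have hq := Real.sqrt_pos.2 hr1
  calc
    _ = ∫⁻ s in Ioo 1 r, ∫⁻ v in Ioo (0 : ℝ) 1,
        ENNReal.ofReal (tailConst m * √v ^ m) *
          ENNReal.ofReal (s * (√(s ^ 2 - v) ^ 3)⁻¹ * (√(r ^ 2 - s ^ 2))⁻¹) := by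
      refine setLIntegral_congr_fun measurableSet_Ioo fun s hs => ?_
      have hs0 : 0 < s := by linarith [hs.1]
      rw [show tailConst m * s * tailIntegral m s * (√(r ^ 2 - s ^ 2))⁻¹ =
          (tailConst m * s * (√(r ^ 2 - s ^ 2))⁻¹) * tailIntegral m s by ring,
        ENNReal.ofReal_mul (by positivity), ofReal_tailIntegral m hs.1,
        ← lintegral_const_mul' _ _ ENNReal.ofReal_ne_top]
      refine lintegral_congr fun v => ?_
      rw [← ENNReal.ofReal_mul (by positivity), ← ENNReal.ofReal_mul (by positivity)]
      congr 1
      ring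
    _ = ∫⁻ v in Ioo (0 : ℝ) 1, ∫⁻ s in Ioo 1 r,
        ENNReal.ofReal (tailConst m * √v ^ m) *
          ENNReal.ofReal (s * (√(s ^ 2 - v) ^ 3)⁻¹ * (√(r ^ 2 - s ^ 2))⁻¹) :=
      lintegral_lintegral_swap (by unfold Function.uncurry; fun_prop)
    -- The variable `s` is new here: the old one has been integrated out, and `√v ^ m` is replaced
    -- by `(betaHalf m)⁻¹ ∫ sᵐ (v - s²)^{-1/2} ds`.
    _ = ∫⁻ v in Ioo (0 : ℝ) 1, ∫⁻ s in Ioo 0 √v,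
        ENNReal.ofReal (tailConst m * (betaHalf m)⁻¹ * √(r ^ 2 - 1) *
          (s ^ m * (√(v - s ^ 2))⁻¹ * (√(1 - v))⁻¹ * (r ^ 2 - v)⁻¹)) := by
      refine setLIntegral_congr_fun measurableSet_Ioo fun v hv => ?_
      have h1 : 0 < 1 - v := by linarith [hv.2]
      have h2 : 0 < r ^ 2 - v := by linarith
      have hsv := Real.sqrt_pos.2 hv.1
      have hbeta := lintegral_pow_mul_inv_sqrt m hsv
      rw [Real.sq_sqrt hv.1.le] at hbeta
      rw [lintegral_const_mul' _ _ ENNReal.ofReal_ne_top, lintegral_tail_kernel hv.2 hr,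
        ← ENNReal.ofReal_mul (by positivity)]
      calc
        _ = ENNReal.ofReal (tailConst m * (betaHalf m)⁻¹ * √(r ^ 2 - 1) * (√(1 - v))⁻¹ *
            (r ^ 2 - v)⁻¹) * ENNReal.ofReal (√v ^ m * betaHalf m) := by
          rw [← ENNReal.ofReal_mul (by positivity)]
          congr 1
          field_simp
        _ = _ := by
          rw [← hbeta, ← lintegral_const_mul' _ _ ENNReal.ofReal_ne_top]
          refine lintegral_congr fun s => ?_
          rw [← ENNReal.ofReal_mul (by positivity)]
          congr 1
          ring
    _ = ∫⁻ s in Ioo (0 : ℝ) 1, ∫⁻ v in Ioo (s ^ 2) 1,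
        ENNReal.ofReal (tailConst m * (betaHalf m)⁻¹ * √(r ^ 2 - 1) *
          (s ^ m * (√(v - s ^ 2))⁻¹ * (√(1 - v))⁻¹ * (r ^ 2 - v)⁻¹)) :=
      lintegral_triangle_swap (by unfold Function.uncurry; fun_prop)
    _ = _ := by
      refine setLIntegral_congr_fun measurableSet_Ioo fun s hs => ?_
      have hs0 : 0 < s := hs.1
      have hs1 : s ^ 2 < 1 := by nlinarith [hs.2]
      have hrs : 0 < r ^ 2 - s ^ 2 := by linarith
      have hqs := Real.sqrt_pos.2 hrs
      calc
        _ = ∫⁻ v in Ioo (s ^ 2) 1, ENNReal.ofReal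
            (tailConst m * (betaHalf m)⁻¹ * √(r ^ 2 - 1) * s ^ m) * ENNReal.ofReal
            ((√(v - s ^ 2))⁻¹ * (√(1 - v))⁻¹ * (r ^ 2 - v)⁻¹) := by
          refine lintegral_congr fun v => ?_
          rw [← ENNReal.ofReal_mul (by positivity)]
          congr 1
          ring
        _ = _ := by
          rw [lintegral_const_mul' _ _ ENNReal.ofReal_ne_top,
            lintegral_arcsin_kernel hs1 (by nlinarith : 1 < r ^ 2),
            ← ENNReal.ofReal_mul (by positivity), ← hKB]
          congr 1
          have := Real.pi_pos
          field_simp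

/-! ### The Abel equation for lines, with absolute bounds -/

lemma unitSphereArea_pos {d : ℝ} (hd : 0 < d) : 0 < unitSphereArea d := by
  have := Real.Gamma_pos_of_pos (half_pos hd)
  have := Real.rpow_pos_of_pos Real.pi_pos (d / 2)
  unfold unitSphereArea
  positivity

lemma abelConst_pos {n k : ℕ} (hk : 0 < k) (hkn : k < n) : 0 < abelConst n k := by
  have h1 : (0 : ℝ) < k := by exact_mod_cast hk
  have h2 : (k : ℝ) < n := by exact_mod_cast hkn
  exact div_pos (mul_pos (unitSphereArea_pos h1) (unitSphereArea_pos (by linarith)))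
    (unitSphereArea_pos (by linarith))

/-- This normalization says that `c ρ⁻ᵐ sᵐ (ρ² - s²)^{-1/2}` has mass one on `(0, ρ)`. It settles
the Abel equation for `r ≤ 1` and later identifies the constant in the law of the projection. -/
lemma abelConst_one_mul_betaHalf (m : ℕ) : abelConst (m + 2) 1 * betaHalf m = 1 := by
  have g1 := Real.Gamma_pos_of_pos (s := (m : ℝ) / 2 + 1) (by positivity)
  have g2 := Real.Gamma_pos_of_pos (s := ((m : ℝ) + 1) / 2) (by positivity)
  have hp := Real.rpow_pos_of_pos Real.pi_pos
  have e : Real.pi ^ ((m : ℝ) / 2 + 1) = Real.pi ^ (((m : ℝ) + 1) / 2) * √Real.pi := by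
    rw [Real.sqrt_eq_rpow, ← Real.rpow_add Real.pi_pos]
    congr 1
    ring
  rw [betaHalf, ProbabilityTheory.beta, Real.Gamma_one_half_eq, abelConst, unitSphereArea,
    unitSphereArea, unitSphereArea,
    show ((m : ℝ) + 1) / 2 + 1 / 2 = (m : ℝ) / 2 + 1 by ring,
    show (((1 : ℕ) : ℝ) / 2) = 1 / 2 by norm_num,
    show (((m + 2 : ℕ) : ℝ) - ((1 : ℕ) : ℝ)) / 2 = ((m : ℝ) + 1) / 2 by push_cast; ring,
    show ((m + 2 : ℕ) : ℝ) / 2 = (m : ℝ) / 2 + 1 by push_cast; ring, e, Real.Gamma_one_half_eq,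
    ← Real.sqrt_eq_rpow]
  have h1 := hp (((m : ℝ) + 1) / 2)
  have h := Real.sqrt_pos.2 Real.pi_pos
  field_simp

lemma abelIntegrand_one (m : ℕ) (w : ℝ → ℝ) {r s : ℝ} (hs : s ∈ Ioo 0 r) :
    abelIntegrand (m + 2) 1 w r s = s ^ m * w s * (√(r ^ 2 - s ^ 2))⁻¹ := by
  have h : 0 ≤ r ^ 2 - s ^ 2 := by nlinarith [hs.1, hs.2]
  rw [abelIntegrand, show ((m + 2 : ℕ) : ℝ) - ((1 : ℕ) : ℝ) - 1 = (m : ℝ) by push_cast; ring,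
    Real.rpow_natCast, show ((1 : ℕ) : ℝ) / 2 - 1 = -(1 / 2) by norm_num, Real.rpow_neg h,
    ← Real.sqrt_eq_rpow]

lemma integrableOn_and_integral_of_lintegral {f : ℝ → ℝ} {s : Set ℝ} {c : ℝ}
    (hs : MeasurableSet s) (hf : Measurable f)
    (h0 : ∀ x ∈ s, 0 ≤ f x) (hc : 0 ≤ c)
    (h : ∫⁻ x in s, ENNReal.ofReal (f x) = ENNReal.ofReal c) :
    IntegrableOn f s ∧ ∫ x in s, f x = c := by
  have h0' : 0 ≤ᵐ[volume.restrict s] f := by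
    filter_upwards [ae_restrict_mem hs] with x hx using h0 x hx
  refine ⟨(lintegral_ofReal_ne_top_iff_integrable hf.aestronglyMeasurable h0').1
    (by rw [h]; exact ENNReal.ofReal_ne_top), ?_⟩
  rw [integral_eq_lintegral_of_nonneg_ae h0' hf.aestronglyMeasurable, h, ENNReal.toReal_ofReal hc]

/-- For `r > 1` this is the integral `∫₀¹ sᵐ (r² - s²)^{-1/2} ds`. -/
noncomputable def abelHead (m : ℕ) (r : ℝ) : ℝ := ∫ s in Ioo (0 : ℝ) 1, s ^ m * (√(r ^ 2 - s ^ 2))⁻¹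

lemma abelHead_nonneg (m : ℕ) (r : ℝ) : 0 ≤ abelHead m r :=
  setIntegral_nonneg measurableSet_Ioo fun s hs => by have := hs.1; positivity

lemma integrableOn_head (m : ℕ) {r : ℝ} (hr : 1 < r) :
    IntegrableOn (fun s => s ^ m * (√(r ^ 2 - s ^ 2))⁻¹) (Ioo 0 1) := by
  refine (ContinuousOn.integrableOn_Icc (a := 0) ?_).mono_set Ioo_subset_Icc_self
  refine ContinuousOn.mul (by fun_prop) (ContinuousOn.inv₀ (by fun_prop) fun v hv => ?_)
  have : 0 < r ^ 2 - v ^ 2 := by nlinarith [hv.1, hv.2]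
  exact (Real.sqrt_pos.2 this).ne'

lemma lintegral_head (m : ℕ) {r : ℝ} (hr : 1 < r) :
    ∫⁻ s in Ioo 0 1, ENNReal.ofReal (s ^ m * (√(r ^ 2 - s ^ 2))⁻¹) =
      ENNReal.ofReal (abelHead m r) := by
  refine (ofReal_integral_eq_lintegral_ofReal (integrableOn_head m hr) ?_).symm
  filter_upwards [ae_restrict_mem measurableSet_Ioo] with s hs
  have := hs.1
  simp only [Pi.zero_apply]
  positivity

lemma integral_tail (m : ℕ) {r : ℝ} (hr : 1 < r) :
    IntegrableOn (fun s => tailConst m * s * tailIntegral m s * (√(r ^ 2 - s ^ 2))⁻¹) (Ioo 1 r) ∧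
    ∫ s in Ioo 1 r, tailConst m * s * tailIntegral m s * (√(r ^ 2 - s ^ 2))⁻¹ = abelHead m r := by
  refine integrableOn_and_integral_of_lintegral measurableSet_Ioo ?_ (fun s hs => ?_)
    (abelHead_nonneg m r) ((lintegral_tail m hr).trans (lintegral_head m hr))
  · have := measurable_tailIntegral m
    fun_prop
  · have h1 : 0 < s := by linarith [hs.1]
    have h2 := tailConst_pos m
    have h3 := tailIntegral_nonneg m s
    positivity

lemma abelEquationAt_of_le_one (m : ℕ) {r : ℝ} (hr0 : 0 < r) (hr : r ≤ 1) :
    AbelEquationAt (m + 2) 1 nievergeltPsi (xrayW (m + 2)) r := by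
  have hcongr : EqOn (abelIntegrand (m + 2) 1 (xrayW (m + 2)) r)
      (fun s => s ^ m * (√(r ^ 2 - s ^ 2))⁻¹) (Ioo 0 r) := fun s hs => by
    rw [abelIntegrand_one m _ hs, xrayW_of_le_one _ (hs.2.le.trans hr), mul_one]
  have h := integrableOn_and_integral_of_lintegral measurableSet_Ioo
    (f := fun s => s ^ m * (√(r ^ 2 - s ^ 2))⁻¹) (by fun_prop)
    (fun s hs => by have := hs.1; positivity)
    (mul_nonneg (by positivity) (betaHalf_pos m).le) (lintegral_pow_mul_inv_sqrt m hr0)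
  refine ⟨h.1.congr_fun hcongr.symm measurableSet_Ioo, ?_⟩
  rw [setIntegral_congr_fun measurableSet_Ioo hcongr, h.2, nievergeltPsi,
    indicator_of_mem (show r ∈ Icc (0 : ℝ) 1 from ⟨hr0.le, hr⟩),
    show (2 : ℝ) - ((m + 2 : ℕ) : ℝ) = -(m : ℝ) by push_cast; ring, Real.rpow_neg hr0.le,
    Real.rpow_natCast, ← abelConst_one_mul_betaHalf m]
  have := pow_pos hr0 m
  field_simp

lemma Ioo_eq_union_of_one_lt {r : ℝ} (hr : 1 < r) : Ioo 0 r = Ioc (0 : ℝ) 1 ∪ Ioo 1 r :=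
  (Ioc_union_Ioo_eq_Ioo zero_le_one hr).symm

lemma integrableOn_pow_mul_xrayW (m : ℕ) {r : ℝ} (hr : 1 < r) :
    IntegrableOn (fun s => s ^ m * xrayW (m + 2) s * (√(r ^ 2 - s ^ 2))⁻¹) (Ioo 0 r) := by
  rw [Ioo_eq_union_of_one_lt hr]
  refine IntegrableOn.union ?_ ?_
  · refine ((integrableOn_Ioc_iff_integrableOn_Ioo (by simp)).2 (integrableOn_head m hr)).congr_fun
      (fun s hs => ?_) measurableSet_Ioc
    simp only [xrayW_of_le_one _ hs.2, mul_one]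
  · refine (integral_tail m hr).1.neg.congr_fun (fun s hs => ?_) measurableSet_Ioo
    simp only [Pi.neg_apply, pow_mul_xrayW m hs.1]
    ring

lemma abelEquationAt_of_one_lt (m : ℕ) {r : ℝ} (hr : 1 < r) :
    AbelEquationAt (m + 2) 1 nievergeltPsi (xrayW (m + 2)) r := by
  have hcongr : EqOn (abelIntegrand (m + 2) 1 (xrayW (m + 2)) r)
      (fun s => s ^ m * xrayW (m + 2) s * (√(r ^ 2 - s ^ 2))⁻¹) (Ioo 0 r) := fun s hs =>
    abelIntegrand_one m _ hs
  have hi := integrableOn_pow_mul_xrayW m hr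
  refine ⟨hi.congr_fun hcongr.symm measurableSet_Ioo, ?_⟩
  rw [setIntegral_congr_fun measurableSet_Ioo hcongr, nievergeltPsi,
    indicator_of_notMem (fun h : r ∈ Icc (0 : ℝ) 1 => absurd h.2 (not_le.2 hr))]
  rw [Ioo_eq_union_of_one_lt hr] at hi ⊢
  rw [setIntegral_union (by
    rw [Set.disjoint_left]; intro x hx hx'; exact absurd hx.2 (not_le.2 hx'.1)) measurableSet_Ioo
    (hi.mono_set subset_union_left) (hi.mono_set subset_union_right)]
  have e1 : ∫ s in Ioc (0 : ℝ) 1, s ^ m * xrayW (m + 2) s * (√(r ^ 2 - s ^ 2))⁻¹ =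
      abelHead m r := by
    rw [abelHead, ← integral_Ioc_eq_integral_Ioo]
    refine setIntegral_congr_fun measurableSet_Ioc fun s hs => ?_
    simp only [xrayW_of_le_one _ hs.2, mul_one]
  have e2 : ∫ s in Ioo 1 r, s ^ m * xrayW (m + 2) s * (√(r ^ 2 - s ^ 2))⁻¹ = -abelHead m r := by
    rw [← (integral_tail m hr).2, ← integral_neg]
    refine setIntegral_congr_fun measurableSet_Ioo fun s hs => ?_
    simp only [pow_mul_xrayW m hs.1]
    ring
  rw [e1, e2]
  ring

lemma abelEquationAt_xrayW (m : ℕ) {r : ℝ} (hr : 0 < r) :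
    AbelEquationAt (m + 2) 1 nievergeltPsi (xrayW (m + 2)) r := by
  rcases le_or_gt r 1 with h | h
  · exact abelEquationAt_of_le_one m hr h
  · exact abelEquationAt_of_one_lt m h

/-- The absolute values in the Abel integral of `xrayW` contribute at most twice the head. -/
lemma lintegral_abs_xrayW_of_one_lt (m : ℕ) {r : ℝ} (hr : 1 < r) :
    ∫⁻ s in Ioo 0 r, ENNReal.ofReal (s ^ m * |xrayW (m + 2) s| * (√(r ^ 2 - s ^ 2))⁻¹) =
      ENNReal.ofReal (2 * abelHead m r) := by
  rw [Ioo_eq_union_of_one_lt hr, lintegral_union measurableSet_Ioo (by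
    rw [Set.disjoint_left]; intro x hx hx'; exact absurd hx.2 (not_le.2 hx'.1)), two_mul,
    ENNReal.ofReal_add (abelHead_nonneg m r) (abelHead_nonneg m r)]
  congr 1
  · rw [← lintegral_head m hr, setLIntegral_congr (Ioo_ae_eq_Ioc (a := (0 : ℝ)) (b := 1)).symm]
    refine setLIntegral_congr_fun measurableSet_Ioo fun s hs => ?_
    rw [xrayW_of_le_one _ hs.2.le, abs_one, mul_one]
  · rw [← lintegral_head m hr, ← lintegral_tail m hr]
    refine setLIntegral_congr_fun measurableSet_Ioo fun s hs => ?_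
    have h1 : 0 < s := by linarith [hs.1]
    have h2 := tailConst_pos m
    have h3 := tailIntegral_nonneg m s
    have : s ^ m * |xrayW (m + 2) s| = tailConst m * s * tailIntegral m s := by
      rw [← abs_of_pos (pow_pos h1 m), ← abs_mul, pow_mul_xrayW m hs.1, abs_neg,
        abs_of_nonneg (by positivity)]
    simp only [this]

lemma lintegral_abs_xrayW_of_le_one (m : ℕ) {r : ℝ} (hr0 : 0 < r) (hr : r ≤ 1) :
    ∫⁻ s in Ioo 0 r, ENNReal.ofReal (s ^ m * |xrayW (m + 2) s| * (√(r ^ 2 - s ^ 2))⁻¹) =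
      ENNReal.ofReal (r ^ m * betaHalf m) := by
  rw [← lintegral_pow_mul_inv_sqrt m hr0]
  refine setLIntegral_congr_fun measurableSet_Ioo fun s hs => ?_
  rw [xrayW_of_le_one _ (hs.2.le.trans hr), abs_one, mul_one]

/-- For `s < 1 < r` one has `r √(1 - s²) ≤ √(r² - s²)`. The resulting factor `1/r` supplies the last
power in the decay of order `n - 1`. -/
lemma abelHead_le (m : ℕ) {r : ℝ} (hr : 1 < r) : abelHead m r ≤ betaHalf m / r := by
  have h := integrableOn_and_integral_of_lintegral measurableSet_Ioo
    (f := fun s => s ^ m * (√(1 ^ 2 - s ^ 2))⁻¹) (by fun_prop)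
    (fun s hs => by have := hs.1; positivity)
    (mul_nonneg (by positivity) (betaHalf_pos m).le) (lintegral_pow_mul_inv_sqrt m one_pos)
  simp only [one_pow, one_mul] at h
  rw [div_eq_mul_inv, ← h.2, ← integral_mul_const]
  refine setIntegral_mono_on (integrableOn_head m hr) (h.1.mul_const _) measurableSet_Ioo
    fun s hs => ?_
  have h0 := hs.1
  have h1 : 0 < 1 - s ^ 2 := by nlinarith [hs.2]
  have h2 : √(1 - s ^ 2) * r ≤ √(r ^ 2 - s ^ 2) := by
    refine Real.le_sqrt_of_sq_le ?_
    rw [mul_pow, Real.sq_sqrt h1.le]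
    nlinarith [mul_nonneg (sq_nonneg s) (by nlinarith : (0 : ℝ) ≤ r ^ 2 - 1)]
  rw [mul_assoc, ← mul_inv]
  have := Real.sqrt_pos.2 h1
  gcongr

/-- On `(1, r)` the factor `sᵐ · r (r² - s²)^{-1/2}` is at least one, so `|w|` is dominated by `r`
times the absolute Abel integrand, already known to be integrable. -/
lemma integrableOn_xrayW (m : ℕ) {r : ℝ} (hr : 1 < r) :
    IntegrableOn (xrayW (m + 2)) (Ioo 0 r) := by
  have hi := integrableOn_pow_mul_xrayW m hr
  rw [Ioo_eq_union_of_one_lt hr] at hi ⊢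
  refine IntegrableOn.union ?_ ?_
  · exact (integrableOn_const (C := (1 : ℝ)) (by simp)).congr_fun
      (fun s hs => (xrayW_of_le_one _ hs.2).symm) measurableSet_Ioc
  · refine Integrable.mono' ((hi.mono_set subset_union_right).norm.const_mul r)
      (measurable_xrayW m).aestronglyMeasurable ?_
    filter_upwards [ae_restrict_mem measurableSet_Ioo] with s hs
    have h0 : 0 < s := by linarith [hs.1]
    have h1 : 0 < r ^ 2 - s ^ 2 := by nlinarith [hs.1, hs.2]
    have h2 := Real.sqrt_pos.2 h1
    have h3 : √(r ^ 2 - s ^ 2) ≤ r := Real.sqrt_le_iff.2 ⟨by linarith, by nlinarith⟩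
    have h4 : 1 ≤ s ^ m := one_le_pow₀ hs.1.le
    have h5 : 1 ≤ r * (√(r ^ 2 - s ^ 2))⁻¹ := by
      rw [← div_eq_mul_inv, one_le_div h2]; exact h3
    rw [norm_mul, norm_mul, Real.norm_of_nonneg (by positivity : 0 ≤ s ^ m),
      Real.norm_of_nonneg (inv_nonneg.2 h2.le)]
    calc ‖xrayW (m + 2) s‖ = 1 * ‖xrayW (m + 2) s‖ * 1 := by ring
      _ ≤ s ^ m * ‖xrayW (m + 2) s‖ * (r * (√(r ^ 2 - s ^ 2))⁻¹) := by gcongr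
      _ = _ := by ring

lemma locallyIntegrableOn_xrayW (m : ℕ) : LocallyIntegrableOn (xrayW (m + 2)) (Ici 0) := by
  intro x hx
  have hx0 : (0 : ℝ) ≤ x := hx
  -- The right end exceeds `1`, as `integrableOn_xrayW` requires, even when `x = 0`.
  refine ⟨Ico 0 (x + 2), ?_, ?_⟩
  · refine mem_nhdsWithin.2 ⟨Iio (x + 2), isOpen_Iio, by simp, fun y hy => ⟨hy.2, hy.1⟩⟩
  · exact (integrableOn_Ico_iff_integrableOn_Ioo (by simp)).2 (integrableOn_xrayW m (by linarith))

lemma xrayW_two {r : ℝ} : xrayW 2 r = nievergeltW r := by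
  by_cases hr : r ≤ 1
  · rw [xrayW, nievergeltW, if_pos hr, if_pos hr]
  · have hr1 : 1 < r := not_le.1 hr
    have hr0 : 0 < r := by linarith
    have h := pow_mul_xrayW 0 hr1
    have hK : tailConst 0 = 1 / 2 := by
      have := Real.sqrt_pos.2 Real.pi_pos
      rw [tailConst]
      norm_num
      rw [Real.Gamma_one_half_eq]
      field_simp
    have hJ : tailIntegral 0 r = 2 * (√(r ^ 2 - 1))⁻¹ - 2 * r⁻¹ := by
      have hpos : ∀ v ∈ Icc (0 : ℝ) 1, 0 < r ^ 2 - v := fun v hv => by nlinarith [hv.2]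
      rw [tailIntegral, ← integral_Ioc_eq_integral_Ioo, ← intervalIntegral.integral_of_le zero_le_one]
      rw [intervalIntegral.integral_eq_sub_of_hasDerivAt (f := fun v => 2 * (√(r ^ 2 - v))⁻¹)]
      · rw [sub_zero, Real.sqrt_sq hr0.le]
      · intro v hv
        rw [uIcc_of_le zero_le_one] at hv
        have h1 := hpos v hv
        have q1 := Real.sqrt_pos.2 h1
        refine ((((hasDerivAt_id v).const_sub (r ^ 2)).sqrt h1.ne').inv q1.ne' |>.const_mul 2).congr_deriv ?_
        simp only [id, pow_zero, one_mul]
        field_simp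
      · refine ContinuousOn.intervalIntegrable ?_
        rw [uIcc_of_le zero_le_one]
        refine ContinuousOn.mul (by fun_prop) (ContinuousOn.inv₀ (by fun_prop) fun v hv => ?_)
        exact (pow_pos (Real.sqrt_pos.2 (hpos v hv)) 3).ne'
    rw [hK, hJ, pow_zero, one_mul] at h
    rw [nievergeltW, if_neg hr, show xrayW 2 r = xrayW (0 + 2) r from rfl, h]
    field_simp
    ring

/-! ### Orthogonal splitting and polar coordinates -/

section Geometry

variable {E : Type*} [NormedAddCommGroup E] [InnerProductSpace ℝ E] [FiniteDimensional ℝ E]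
  [MeasurableSpace E] [BorelSpace E]

/-- The sum map `Kᗮ × K ≃ E` as a measurable equivalence. -/
noncomputable def orthoSplit (K : Submodule ℝ E) : (Kᗮ × K) ≃ᵐ E :=
  (MeasurableEquiv.prodComm.trans (MeasurableEquiv.toLp 2 (K × Kᗮ))).trans
    K.orthogonalDecomposition.symm.toHomeomorph.toMeasurableEquiv

lemma orthoSplit_apply (K : Submodule ℝ E) (q : Kᗮ × K) :
    orthoSplit K q = (q.2 : E) + (q.1 : E) := by
  simp [orthoSplit, MeasurableEquiv.prodComm]

lemma measurePreserving_orthoSplit (K : Submodule ℝ E) :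
    MeasurePreserving (orthoSplit K) (volume : Measure (Kᗮ × K)) volume :=
  ((Measure.measurePreserving_swap (μ := (volume : Measure Kᗮ)) (ν := (volume : Measure K))).trans
    (WithLp.volume_preserving_toLp K Kᗮ)).trans K.orthogonalDecomposition.symm.measurePreserving

lemma lintegral_orthoSplit (K : Submodule ℝ E) {F : E → ℝ≥0∞} (hF : AEMeasurable F) :
    ∫⁻ y, F y = ∫⁻ u : Kᗮ, ∫⁻ x : K, F ((x : E) + (u : E)) := by
  rw [← (measurePreserving_orthoSplit K).lintegral_comp_emb (orthoSplit K).measurableEmbedding,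
    Measure.volume_eq_prod, lintegral_prod]
  · simp only [orthoSplit_apply]
  · exact hF.comp_quasiMeasurePreserving (measurePreserving_orthoSplit K).quasiMeasurePreserving

lemma lintegral_polar [Nontrivial E] {F : E → ℝ≥0∞} (hF : Measurable F) :
    ∫⁻ y, F y = ∫⁻ θ : Metric.sphere (0 : E) 1, (∫⁻ r in Ioi (0 : ℝ),
      ENNReal.ofReal (r ^ (Module.finrank ℝ E - 1)) * F (r • (θ : E)))
        ∂(volume : Measure E).toSphere := by
  have hm : Measurable fun p : Metric.sphere (0 : E) 1 × Ioi (0 : ℝ) =>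
      F ((p.2 : ℝ) • (p.1 : E)) := by fun_prop
  have h := (volume : Measure E).measurePreserving_homeomorphUnitSphereProd.lintegral_comp_emb
    (Homeomorph.measurableEmbedding _)
    (fun p : Metric.sphere (0 : E) 1 × Ioi (0 : ℝ) => F ((p.2 : ℝ) • (p.1 : E)))
  rw [lintegral_prod _ hm.aemeasurable] at h
  calc
    ∫⁻ y, F y = ∫⁻ y in ({0}ᶜ : Set E), F y := by rw [restrict_compl_singleton]
    _ = ∫⁻ y : ({0}ᶜ : Set E), F y ∂(volume : Measure E).comap (↑) :=
      (lintegral_subtype_comap (measurableSet_singleton _).compl F).symm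
    _ = _ := by
      refine Eq.trans (lintegral_congr fun y => ?_) (h.trans (lintegral_congr fun θ => ?_))
      · have hy : (y : E) ≠ 0 := y.2
        congr 1
        simp [smul_smul, norm_ne_zero_iff.2 hy]
      · rw [Measure.volumeIoiPow, lintegral_withDensity_eq_lintegral_mul]
        · rw [← lintegral_subtype_comap measurableSet_Ioi]
          rfl
        · fun_prop
        · fun_prop

lemma lintegral_radial [Nontrivial E] {G : ℝ → ℝ≥0∞} (hG : Measurable G) :
    ∫⁻ y : E, G ‖y‖ = (volume : Measure E).toSphere univ *
      ∫⁻ r in Ioi (0 : ℝ), ENNReal.ofReal (r ^ (Module.finrank ℝ E - 1)) * G r := by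
  rw [lintegral_polar (by fun_prop), mul_comm, ← lintegral_const]
  refine lintegral_congr fun θ => setLIntegral_congr_fun measurableSet_Ioi fun r hr => ?_
  have hr0 : (0 : ℝ) < r := hr
  simp only [norm_smul, norm_eq_of_mem_sphere, mul_one, Real.norm_of_nonneg hr0.le]

end Geometry

/-! ### The law of the projected length for a random direction -/

lemma lintegral_pow_Ioo (m : ℕ) :
    ∫⁻ r in Ioi (0 : ℝ), ENNReal.ofReal (r ^ (m + 1)) * (Iio (1 : ℝ)).indicator 1 r =
      ENNReal.ofReal (1 / (m + 2)) := by
  have h := lintegral_deriv_of_nonneg (F := fun r : ℝ => r ^ (m + 2) / (m + 2))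
    (f := fun r => r ^ (m + 1)) zero_le_one (by fun_prop)
    (fun r _ => by
      refine ((hasDerivAt_pow (m + 2) r).div_const _).congr_deriv ?_
      push_cast
      field_simp)
    (fun r hr => pow_nonneg hr.1.le _)
  simp only [one_pow, ne_eq, Nat.add_eq_zero_iff, OfNat.ofNat_ne_zero, and_false,
    not_false_eq_true, zero_pow, zero_div, sub_zero] at h
  rw [← h, ← Ioi_inter_Iio, inter_comm, ← Measure.restrict_restrict measurableSet_Iio,
    ← lintegral_indicator measurableSet_Iio]
  refine lintegral_congr fun r => ?_
  by_cases hr : r ∈ Iio (1 : ℝ) <;> simp [hr, indicator]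

/-- Here `s` and `t` are the norms of the components of a point orthogonal and parallel to a fixed
vector. Polar coordinates in the quadrant separate the radial cutoff from the angle, on which alone
`H` depends. -/
lemma lintegral_quadrant_polar (m : ℕ) {ρ : ℝ} {H : ℝ → ℝ≥0∞} (hH : Measurable H) :
    ∫⁻ s in Ioi (0 : ℝ), ENNReal.ofReal (s ^ m) * ∫⁻ t in Ioi (0 : ℝ),
        H (ρ * s / √(s ^ 2 + t ^ 2)) * (Iio (1 : ℝ)).indicator 1 (√(s ^ 2 + t ^ 2)) =
      ENNReal.ofReal (1 / (m + 2)) *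
        ∫⁻ φ in Ioo 0 (Real.pi / 2), ENNReal.ofReal (Real.cos φ ^ m) * H (ρ * Real.cos φ) := by
  set g : ℝ → ℝ≥0∞ := (Iio (1 : ℝ)).indicator 1 with hg
  have hgm : Measurable g := measurable_one.indicator measurableSet_Iio
  set Q : ℝ × ℝ → ℝ≥0∞ := fun q => ENNReal.ofReal (q.1 ^ m) *
    (H (ρ * q.1 / √(q.1 ^ 2 + q.2 ^ 2)) * g (√(q.1 ^ 2 + q.2 ^ 2))) with hQ
  have hQm : Measurable Q := by fun_prop
  have hS : MeasurableSet (Ioi (0 : ℝ) ×ˢ Ioi (0 : ℝ)) := measurableSet_Ioi.prod measurableSet_Ioi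
  calc
    _ = ∫⁻ s in Ioi (0 : ℝ), ∫⁻ t in Ioi (0 : ℝ), Q (s, t) := by
      refine lintegral_congr fun s => ?_
      rw [← lintegral_const_mul' _ _ ENNReal.ofReal_ne_top]
    _ = ∫⁻ q in Ioi (0 : ℝ) ×ˢ Ioi (0 : ℝ), Q q := by
      rw [Measure.volume_eq_prod, ← Measure.prod_restrict, lintegral_prod _ hQm.aemeasurable]
    _ = ∫⁻ q, (Ioi (0 : ℝ) ×ˢ Ioi (0 : ℝ)).indicator Q q := (lintegral_indicator hS _).symm
    _ = ∫⁻ q in Ioi (0 : ℝ) ×ˢ Ioo (-Real.pi) Real.pi, ENNReal.ofReal q.1 *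
          (Ioi (0 : ℝ) ×ˢ Ioi (0 : ℝ)).indicator Q (q.1 * Real.cos q.2, q.1 * Real.sin q.2) := by
      rw [← lintegral_comp_polarCoord_symm]
      rfl
    _ = ∫⁻ q in Ioi (0 : ℝ) ×ˢ Ioo (-Real.pi) Real.pi,
          (ENNReal.ofReal (q.1 ^ (m + 1)) * g q.1) *
          (Ioo 0 (Real.pi / 2)).indicator
            (fun φ => ENNReal.ofReal (Real.cos φ ^ m) * H (ρ * Real.cos φ)) q.2 := by
      refine setLIntegral_congr_fun (measurableSet_Ioi.prod measurableSet_Ioo) fun q hq => ?_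
      obtain ⟨r, φ⟩ := q
      obtain ⟨hr, h1, h2⟩ := hq
      simp only at hr h1 h2 ⊢
      have hr0 : 0 < r := hr
      by_cases hφ : φ ∈ Ioo 0 (Real.pi / 2)
      · have hc : 0 < Real.cos φ := Real.cos_pos_of_mem_Ioo ⟨by linarith [hφ.1], hφ.2⟩
        have hs : 0 < Real.sin φ := Real.sin_pos_of_pos_of_lt_pi hφ.1 h2
        rw [indicator_of_mem hφ, indicator_of_mem (show (r * Real.cos φ, r * Real.sin φ) ∈
          Ioi (0 : ℝ) ×ˢ Ioi (0 : ℝ) from ⟨mul_pos hr0 hc, mul_pos hr0 hs⟩)]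
        have e : √((r * Real.cos φ) ^ 2 + (r * Real.sin φ) ^ 2) = r := by
          rw [mul_pow, mul_pow, ← mul_add, Real.cos_sq_add_sin_sq, mul_one, Real.sqrt_sq hr0.le]
        simp only [hQ, e]
        rw [show ρ * (r * Real.cos φ) / r = ρ * Real.cos φ by field_simp, mul_pow,
          ENNReal.ofReal_mul (by positivity), pow_succ, ENNReal.ofReal_mul (by positivity)]
        ring
      · rw [indicator_of_notMem hφ, indicator_of_notMem, mul_zero, mul_zero]
        rintro ⟨hc, hs⟩
        have hc' : 0 < Real.cos φ := pos_of_mul_pos_right hc hr0.le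
        have hs' : 0 < Real.sin φ := pos_of_mul_pos_right hs hr0.le
        refine hφ ⟨?_, ?_⟩
        · by_contra h
          have := Real.sin_nonpos_of_nonpos_of_neg_pi_le (not_lt.1 h) h1.le
          linarith
        · by_contra h
          have := Real.cos_nonpos_of_pi_div_two_le_of_le (not_lt.1 h) (by linarith)
          linarith
    _ = _ := by
      have hm2 : Measurable fun φ => (Ioo 0 (Real.pi / 2)).indicator
            (fun φ => ENNReal.ofReal (Real.cos φ ^ m) * H (ρ * Real.cos φ)) φ :=
        Measurable.indicator (by fun_prop) measurableSet_Ioo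
      rw [Measure.volume_eq_prod, ← Measure.prod_restrict,
        lintegral_prod_mul (f := fun r => ENNReal.ofReal (r ^ (m + 1)) * g r) (by fun_prop)
          hm2.aemeasurable, lintegral_pow_Ioo]
      congr 1
      rw [lintegral_indicator measurableSet_Ioo, Measure.restrict_restrict measurableSet_Ioo,
        inter_eq_left.2]
      have := Real.pi_pos
      exact fun x hx => ⟨by linarith [hx.1], by linarith [hx.2]⟩

lemma lintegral_comp_mul_cos (m : ℕ) {ρ : ℝ} (hρ : 0 < ρ) (H : ℝ → ℝ≥0∞) :
    ∫⁻ s in Ioo 0 ρ, H s * ENNReal.ofReal (s ^ m * (√(ρ ^ 2 - s ^ 2))⁻¹) =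
      ENNReal.ofReal (ρ ^ m) *
      ∫⁻ φ in Ioo 0 (Real.pi / 2), ENNReal.ofReal (Real.cos φ ^ m) * H (ρ * Real.cos φ) := by
  have hcos : ∀ φ ∈ Ioo 0 (Real.pi / 2), 0 < Real.cos φ := fun φ hφ =>
    Real.cos_pos_of_mem_Ioo ⟨by linarith [hφ.1, Real.pi_pos], hφ.2⟩
  have hsin : ∀ φ ∈ Ioo 0 (Real.pi / 2), 0 < Real.sin φ := fun φ hφ =>
    Real.sin_pos_of_pos_of_lt_pi hφ.1 (by linarith [hφ.2, Real.pi_pos])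
  have himg : (fun φ : ℝ => ρ * Real.cos φ) '' Ioo 0 (Real.pi / 2) = Ioo 0 ρ := by
    ext s
    constructor
    · rintro ⟨φ, hφ, rfl⟩
      have h1 := hcos φ hφ
      have h2 : Real.cos φ < 1 := by
        have := Real.sin_sq_add_cos_sq φ
        have := hsin φ hφ
        nlinarith
      exact ⟨by positivity, by nlinarith⟩
    · rintro ⟨h0, h1⟩
      have h2 : s / ρ < 1 := (div_lt_one hρ).2 h1
      have h3 : 0 < s / ρ := by positivity
      refine ⟨Real.arccos (s / ρ), ⟨Real.arccos_pos.2 h2, Real.arccos_lt_pi_div_two.2 h3⟩, ?_⟩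
      simp only [Real.cos_arccos (by linarith) h2.le]
      field_simp
  have hinj : InjOn (fun φ : ℝ => ρ * Real.cos φ) (Ioo 0 (Real.pi / 2)) := by
    intro x hx y hy h
    have : Real.cos x = Real.cos y := by simpa [hρ.ne'] using h
    have hp := Real.pi_pos
    exact Real.injOn_cos ⟨hx.1.le, by linarith [hx.2]⟩ ⟨hy.1.le, by linarith [hy.2]⟩ this
  rw [← himg, lintegral_image_eq_lintegral_abs_deriv_mul measurableSet_Ioo
    (f' := fun φ => ρ * -Real.sin φ)
    (fun x _ => ((Real.hasDerivAt_cos x).const_mul ρ).hasDerivWithinAt) hinj,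
    ← lintegral_const_mul' _ _ ENNReal.ofReal_ne_top]
  refine setLIntegral_congr_fun measurableSet_Ioo fun φ hφ => ?_
  have h1 := hcos φ hφ
  have h2 := hsin φ hφ
  have e : √(ρ ^ 2 - (ρ * Real.cos φ) ^ 2) = ρ * Real.sin φ := by
    rw [← Real.sqrt_sq (by positivity : 0 ≤ ρ * Real.sin φ)]
    congr 1
    have := Real.sin_sq_add_cos_sq φ
    linear_combination (-ρ ^ 2) * this
  have e2 : |ρ * -Real.sin φ| = ρ * Real.sin φ := by
    rw [mul_neg, abs_neg, abs_of_pos (by positivity)]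
  rw [e, e2, mul_comm (H _), ← mul_assoc, ← mul_assoc, ← ENNReal.ofReal_mul (by positivity),
    ← ENNReal.ofReal_mul (by positivity)]
  congr 2
  rw [mul_pow]
  field_simp

section SphereAverage

variable {E : Type*} [NormedAddCommGroup E] [InnerProductSpace ℝ E] [FiniteDimensional ℝ E]
  [MeasurableSpace E] [BorelSpace E]

/-- The integrand is extended to be constant along rays, cut off to the unit ball, and integrated in
two ways: in polar coordinates, and by splitting along the line of `z`. The common radial factor
`1/(m+2)` is finite and nonzero, so it cancels. Only the independence of `C` from `H` matters. -/
lemma lintegral_sphere_perp {m : ℕ} (hE : Module.finrank ℝ E = m + 2) {z : E} (hz : z ≠ 0) :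
    ∃ C : ℝ≥0∞, ∀ H : ℝ → ℝ≥0∞, Measurable H →
      ∫⁻ θ : Metric.sphere (0 : E) 1, H (√(‖z‖ ^ 2 - inner ℝ (θ : E) z ^ 2))
        ∂(volume : Measure E).toSphere =
      C * ∫⁻ s in Ioo 0 ‖z‖, H s * ENNReal.ofReal (s ^ m * (√(‖z‖ ^ 2 - s ^ 2))⁻¹) := by
  have hρ : 0 < ‖z‖ := norm_pos_iff.2 hz
  set K : Submodule ℝ E := Submodule.span ℝ {z} with hK
  have hKd : Module.finrank ℝ K = 1 := finrank_span_singleton hz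
  have hKd' : Module.finrank ℝ Kᗮ = m + 1 := by
    have := K.finrank_add_finrank_orthogonal
    omega
  have : Nontrivial E := ⟨z, 0, hz⟩
  have : Nontrivial K := Module.nontrivial_of_finrank_pos (R := ℝ) (by omega)
  have : Nontrivial Kᗮ := Module.nontrivial_of_finrank_pos (R := ℝ) (by omega)
  refine ⟨(volume : Measure Kᗮ).toSphere univ * (volume : Measure K).toSphere univ *
    (ENNReal.ofReal (‖z‖ ^ m))⁻¹, fun H hH => ?_⟩
  set g : ℝ → ℝ≥0∞ := (Iio (1 : ℝ)).indicator 1 with hg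
  have hgm : Measurable g := measurable_one.indicator measurableSet_Iio
  have hAne : ENNReal.ofReal (1 / ((m : ℝ) + 2)) ≠ 0 :=
    (ENNReal.ofReal_pos.2 (by positivity)).ne'
  set Q : E → ℝ≥0∞ := fun y => H (√(‖z‖ ^ 2 - (inner ℝ y z / ‖y‖) ^ 2)) * g ‖y‖ with hQ
  have hQm : Measurable Q := by fun_prop
  have h1 : ∫⁻ y, Q y = (∫⁻ θ : Metric.sphere (0 : E) 1, H (√(‖z‖ ^ 2 - inner ℝ (θ : E) z ^ 2))
        ∂(volume : Measure E).toSphere) * ENNReal.ofReal (1 / ((m : ℝ) + 2)) := by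
    rw [lintegral_polar hQm, ← lintegral_mul_const _ (by fun_prop)]
    have hm' : Measurable fun r : ℝ =>
      ENNReal.ofReal (r ^ (m + 1)) * (Iio (1 : ℝ)).indicator 1 r := Measurable.mul (by fun_prop) hgm
    refine lintegral_congr fun θ => ?_
    rw [← lintegral_pow_Ioo, ← lintegral_const_mul _ hm']
    refine setLIntegral_congr_fun measurableSet_Ioi fun r hr => ?_
    have hr0 : (0 : ℝ) < r := hr
    simp only [hQ, norm_smul, norm_eq_of_mem_sphere, mul_one, Real.norm_of_nonneg hr0.le,
      real_inner_smul_left, hE, mul_div_cancel_left₀ _ hr0.ne', ← hg]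
    rw [show m + 2 - 1 = m + 1 by omega]
    ring
  have h2 : ∫⁻ y, Q y = (volume : Measure Kᗮ).toSphere univ * (volume : Measure K).toSphere univ *
      (ENNReal.ofReal (1 / ((m : ℝ) + 2)) *
      ∫⁻ φ in Ioo 0 (Real.pi / 2), ENNReal.ofReal (Real.cos φ ^ m) * H (‖z‖ * Real.cos φ)) := by
    rw [lintegral_orthoSplit K hQm.aemeasurable, ← lintegral_quadrant_polar m hH, mul_assoc,
      ← lintegral_const_mul' _ _ (measure_ne_top _ _)]
    have hinner : ∀ u : Kᗮ, u ≠ 0 → ∀ x : K, Q ((x : E) + (u : E)) =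
        H (‖z‖ * ‖u‖ / √(‖u‖ ^ 2 + ‖x‖ ^ 2)) * g (√(‖u‖ ^ 2 + ‖x‖ ^ 2)) := by
      intro u hu x
      have hpos : 0 < ‖u‖ ^ 2 + ‖x‖ ^ 2 := by
        have := norm_pos_iff.2 hu
        positivity
      have hxu : inner ℝ (x : E) (u : E) = 0 := Submodule.inner_right_of_mem_orthogonal x.2 u.2
      have hzu : inner ℝ (u : E) z = 0 :=
        Submodule.inner_left_of_mem_orthogonal (Submodule.mem_span_singleton_self z) u.2
      have hn : ‖(x : E) + (u : E)‖ = √(‖u‖ ^ 2 + ‖x‖ ^ 2) := by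
        rw [← Real.sqrt_sq (norm_nonneg _), sq,
          norm_add_sq_eq_norm_sq_add_norm_sq_of_inner_eq_zero _ _ hxu]
        congr 1
        simp only [Submodule.coe_norm]
        ring
      obtain ⟨c, hc⟩ := Submodule.mem_span_singleton.1 x.2
      have hxz : inner ℝ (x : E) z ^ 2 = ‖x‖ ^ 2 * ‖z‖ ^ 2 := by
        rw [Submodule.norm_coe x |>.symm, ← hc, real_inner_smul_left, real_inner_self_eq_norm_sq, norm_smul,
          mul_pow, mul_pow, Real.norm_eq_abs, sq_abs]
        ring
      simp only [hQ, hn, inner_add_left, hzu, add_zero]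
      congr 2
      rw [div_pow, Real.sq_sqrt hpos.le, hxz,
        show ‖z‖ ^ 2 - ‖x‖ ^ 2 * ‖z‖ ^ 2 / (‖u‖ ^ 2 + ‖x‖ ^ 2) =
          (‖z‖ * ‖u‖) ^ 2 / (‖u‖ ^ 2 + ‖x‖ ^ 2) by field_simp; ring,
        Real.sqrt_div (by positivity), Real.sqrt_sq (by positivity)]
    set I : ℝ → ℝ≥0∞ := fun s => ∫⁻ t in Ioi (0 : ℝ),
      H (‖z‖ * s / √(s ^ 2 + t ^ 2)) * g (√(s ^ 2 + t ^ 2)) with hI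
    have hIm : Measurable I := by
      refine Measurable.lintegral_prod_right (f := fun s t =>
        H (‖z‖ * s / √(s ^ 2 + t ^ 2)) * g (√(s ^ 2 + t ^ 2))) ?_
      unfold Function.uncurry
      fun_prop
    have hne : ∀ᵐ u : Kᗮ, u ≠ 0 := compl_mem_ae_iff.2 (measure_singleton 0)
    calc
      _ = ∫⁻ u : Kᗮ, (volume : Measure K).toSphere univ * I ‖u‖ := by
        refine lintegral_congr_ae ?_
        filter_upwards [hne] with u hu
        simp only [hinner u hu]
        rw [lintegral_radial (E := K)
          (G := fun t => H (‖z‖ * ‖u‖ / √(‖u‖ ^ 2 + t ^ 2)) * g (√(‖u‖ ^ 2 + t ^ 2))) (by fun_prop),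
          hKd]
        simp [hI]
      _ = _ := by
        rw [lintegral_const_mul' _ _ (measure_ne_top _ _), lintegral_radial hIm, hKd',
          mul_left_comm, ← lintegral_const_mul' _ _ (measure_ne_top _ _)]
        rfl
  rw [lintegral_comp_mul_cos m hρ]
  have hρm : ENNReal.ofReal (‖z‖ ^ m) ≠ 0 := (ENNReal.ofReal_pos.2 (by positivity)).ne'
  have h3 := h1.symm.trans h2
  rw [mul_left_comm, mul_comm] at h3
  rw [(ENNReal.mul_right_inj hAne ENNReal.ofReal_ne_top).1 h3, mul_assoc, mul_assoc, mul_assoc,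
    ← mul_assoc (ENNReal.ofReal (‖z‖ ^ m))⁻¹, ENNReal.inv_mul_cancel hρm ENNReal.ofReal_ne_top,
    one_mul]

variable (E) in
/-- The normalized surface measure of the unit sphere. -/
noncomputable def sphereProb : Measure (Metric.sphere (0 : E) 1) :=
  ((volume : Measure E).toSphere univ)⁻¹ • (volume : Measure E).toSphere

instance [Nontrivial E] : IsProbabilityMeasure (sphereProb E) := by
  refine ⟨?_⟩
  rw [sphereProb, Measure.smul_apply, smul_eq_mul]
  refine ENNReal.inv_mul_cancel ?_ (measure_ne_top _ _)
  exact fun h => Measure.toSphere_ne_zero (volume : Measure E) (Measure.measure_univ_eq_zero.1 h)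

/-- The density of `|P_{θ^⊥} z|`, `|z| = ρ`, for a random direction `θ`. -/
noncomputable def perpDensity (m : ℕ) (ρ s : ℝ) : ℝ :=
  abelConst (m + 2) 1 * (ρ ^ m)⁻¹ * (s ^ m * (√(ρ ^ 2 - s ^ 2))⁻¹)

lemma measurable_perpDensity (m : ℕ) (ρ : ℝ) : Measurable (perpDensity m ρ) := by
  unfold perpDensity
  fun_prop

lemma perpDensity_nonneg (m : ℕ) {ρ s : ℝ} (hρ : 0 < ρ) (hs : 0 < s) : 0 ≤ perpDensity m ρ s := by
  have := abelConst_pos one_pos (by omega : 1 < m + 2)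
  unfold perpDensity
  positivity

lemma lintegral_sphereProb_perp {m : ℕ} (hE : Module.finrank ℝ E = m + 2) {z : E} (hz : z ≠ 0)
    {H : ℝ → ℝ≥0∞} (hH : Measurable H) :
    ∫⁻ θ, H (√(‖z‖ ^ 2 - inner ℝ (θ : E) z ^ 2)) ∂(sphereProb E) =
      ∫⁻ s in Ioo 0 ‖z‖, H s * ENNReal.ofReal (perpDensity m ‖z‖ s) := by
  have hρ : 0 < ‖z‖ := norm_pos_iff.2 hz
  have : Nontrivial E := ⟨z, 0, hz⟩
  have hc := abelConst_pos one_pos (by omega : 1 < m + 2)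
  have hb := betaHalf_pos m
  have hcb := abelConst_one_mul_betaHalf m
  obtain ⟨C, hC⟩ := lintegral_sphere_perp hE hz
  -- Testing with `H = 1` determines the unknown constant, since the right side is then a beta
  -- integral.
  have h1 := hC (fun _ => 1) measurable_const
  simp only [one_mul, lintegral_const, lintegral_pow_mul_inv_sqrt m hρ] at h1
  have hp : 0 < ‖z‖ ^ m * betaHalf m := by positivity
  have hp0 : ENNReal.ofReal (‖z‖ ^ m * betaHalf m) ≠ 0 := (ENNReal.ofReal_pos.2 hp).ne'
  have hS0 : (volume : Measure E).toSphere univ ≠ 0 := fun h =>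
    Measure.toSphere_ne_zero (volume : Measure E) (Measure.measure_univ_eq_zero.1 h)
  have hC' : ((volume : Measure E).toSphere univ)⁻¹ * C =
      ENNReal.ofReal (abelConst (m + 2) 1 * (‖z‖ ^ m)⁻¹) := by
    rw [← (ENNReal.mul_left_inj hp0 ENNReal.ofReal_ne_top), mul_assoc, ← h1,
      ENNReal.inv_mul_cancel hS0 (measure_ne_top _ _), ← ENNReal.ofReal_mul (by positivity),
      show abelConst (m + 2) 1 * (‖z‖ ^ m)⁻¹ * (‖z‖ ^ m * betaHalf m) =
        abelConst (m + 2) 1 * betaHalf m by field_simp, hcb, ENNReal.ofReal_one]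
  rw [sphereProb, lintegral_smul_measure, smul_eq_mul, hC H hH, ← mul_assoc, hC',
    ← lintegral_const_mul' _ _ ENNReal.ofReal_ne_top]
  refine lintegral_congr fun s => ?_
  rw [mul_left_comm, ← ENNReal.ofReal_mul (by positivity)]
  rfl

/-- Stating the law as a pushforward measure makes it available for the signed function `xrayW`. -/
lemma map_sphereProb_perp {m : ℕ} (hE : Module.finrank ℝ E = m + 2) {z : E} (hz : z ≠ 0) :
    (sphereProb E).map (fun θ : Metric.sphere (0 : E) 1 => √(‖z‖ ^ 2 - inner ℝ (θ : E) z ^ 2)) =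
      (volume.restrict (Ioo 0 ‖z‖)).withDensity
        (fun s => ENNReal.ofReal (perpDensity m ‖z‖ s)) := by
  ext S hS
  rw [Measure.map_apply (by fun_prop) hS, withDensity_apply _ hS,
    ← lintegral_indicator_one ((by fun_prop : Measurable fun θ : Metric.sphere (0 : E) 1 =>
      √(‖z‖ ^ 2 - inner ℝ (θ : E) z ^ 2)) hS), ← lintegral_indicator hS]
  refine Eq.trans ?_ ((lintegral_sphereProb_perp hE hz
    (measurable_one.indicator hS : Measurable (S.indicator 1))).trans
    (lintegral_congr fun s => ?_))
  · rfl
  · by_cases hs : s ∈ S <;> simp [hs]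

/-- The density of the projected length is the normalized Abel kernel, so this mean is the left side
of the Abel equation at `‖z‖`. -/
lemma integral_sphereProb_xrayW {m : ℕ} (hE : Module.finrank ℝ E = m + 2) {z : E} (hz : z ≠ 0) :
    ∫ θ, xrayW (m + 2) (√(‖z‖ ^ 2 - inner ℝ (θ : E) z ^ 2)) ∂(sphereProb E) =
      nievergeltPsi ‖z‖ := by
  have hρ : 0 < ‖z‖ := norm_pos_iff.2 hz
  have hmeas := measurable_xrayW m
  rw [← integral_map (f := xrayW (m + 2)) (φ := fun θ : Metric.sphere (0 : E) 1 =>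
      √(‖z‖ ^ 2 - inner ℝ (θ : E) z ^ 2)) (by fun_prop) hmeas.aestronglyMeasurable,
    map_sphereProb_perp hE hz, integral_withDensity_eq_integral_toReal_smul
      (measurable_perpDensity m _).ennreal_ofReal (by simp), ← (abelEquationAt_xrayW m hρ).2,
    show (2 : ℝ) - ((m + 2 : ℕ) : ℝ) = -(m : ℝ) by push_cast; ring, Real.rpow_neg hρ.le,
    Real.rpow_natCast, ← integral_const_mul]
  refine setIntegral_congr_fun measurableSet_Ioo fun s hs => ?_
  rw [abelIntegrand_one m _ hs, ENNReal.toReal_ofReal (perpDensity_nonneg m hρ hs.1), perpDensity,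
    smul_eq_mul]
  ring

/-- For `‖z‖ ≤ 1` the mean is one. For `‖z‖ > 1` it is at most `2 ‖z‖^{-(m+1)}`, and `1 + ‖z‖ ≤ 2
‖z‖` accounts for the remaining factor `2^{m+1}`. -/
lemma lintegral_sphereProb_enorm_xrayW_le {m : ℕ} (hE : Module.finrank ℝ E = m + 2) {z : E}
    (hz : z ≠ 0) :
    ∫⁻ θ, ‖xrayW (m + 2) (√(‖z‖ ^ 2 - inner ℝ (θ : E) z ^ 2))‖ₑ ∂(sphereProb E) ≤
      ENNReal.ofReal (2 ^ (m + 2) * (1 + ‖z‖) ^ (-((m : ℝ) + 1))) := by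
  have hρ : 0 < ‖z‖ := norm_pos_iff.2 hz
  have hc := abelConst_pos one_pos (by omega : 1 < m + 2)
  have hcb := abelConst_one_mul_betaHalf m
  have hmeas := measurable_xrayW m
  have hexp : (1 + ‖z‖) ^ (-((m : ℝ) + 1)) = ((1 + ‖z‖) ^ (m + 1))⁻¹ := by
    rw [Real.rpow_neg (by positivity), ← Real.rpow_natCast]
    push_cast
    rfl
  have hkey : ∀ B : ℝ, ∫⁻ s in Ioo 0 ‖z‖,
      ENNReal.ofReal (s ^ m * |xrayW (m + 2) s| * (√(‖z‖ ^ 2 - s ^ 2))⁻¹) = ENNReal.ofReal B →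
      ∫⁻ θ, ‖xrayW (m + 2) (√(‖z‖ ^ 2 - inner ℝ (θ : E) z ^ 2))‖ₑ ∂(sphereProb E) =
        ENNReal.ofReal (abelConst (m + 2) 1 * (‖z‖ ^ m)⁻¹ * B) := by
    intro B hB
    rw [lintegral_sphereProb_perp hE hz (H := fun s => ‖xrayW (m + 2) s‖ₑ) (by fun_prop),
      ENNReal.ofReal_mul (by positivity), ← hB, ← lintegral_const_mul' _ _ ENNReal.ofReal_ne_top]
    refine setLIntegral_congr_fun measurableSet_Ioo fun s hs => ?_
    rw [← ofReal_norm, ← ENNReal.ofReal_mul (norm_nonneg _),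
      ← ENNReal.ofReal_mul (by positivity), perpDensity, Real.norm_eq_abs]
    congr 1
    ring
  rw [hexp]
  rcases le_or_gt ‖z‖ 1 with h | h
  · rw [hkey _ (lintegral_abs_xrayW_of_le_one m hρ h)]
    refine ENNReal.ofReal_le_ofReal ?_
    rw [show abelConst (m + 2) 1 * (‖z‖ ^ m)⁻¹ * (‖z‖ ^ m * betaHalf m) =
      abelConst (m + 2) 1 * betaHalf m by field_simp, hcb, ← div_eq_mul_inv,
      one_le_div (by positivity)]
    calc (1 + ‖z‖) ^ (m + 1) ≤ 2 ^ (m + 1) := by gcongr; linarith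
      _ ≤ 2 ^ (m + 2) := pow_le_pow_right₀ one_le_two (by omega)
  · rw [hkey _ (lintegral_abs_xrayW_of_one_lt m h)]
    refine ENNReal.ofReal_le_ofReal ?_
    have hle := abelHead_le m h
    calc abelConst (m + 2) 1 * (‖z‖ ^ m)⁻¹ * (2 * abelHead m ‖z‖)
        ≤ abelConst (m + 2) 1 * (‖z‖ ^ m)⁻¹ * (2 * (betaHalf m / ‖z‖)) := by gcongr
      _ = 2 * (abelConst (m + 2) 1 * betaHalf m) * (‖z‖ ^ (m + 1))⁻¹ := by
        rw [pow_succ]; field_simp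
      _ = 2 ^ (m + 2) * ((2 * ‖z‖) ^ (m + 1))⁻¹ := by
        rw [hcb, mul_pow]; field_simp; ring
      _ ≤ _ := by gcongr; linarith

end SphereAverage

/-! ### Nonexistence for `k > 1` -/

section Jump

/-- For `k > 1` the left-hand side of the Abel equation is continuous at `r = 1`, where
`nievergeltPsi` jumps; hence there is no solution. -/
lemma not_exists_abel_solution {n k : ℕ} (hk : 1 < k) (hkn : k < n) :
    ¬ ∃ w : ℝ → ℝ, ∀ᵐ r ∂(volume.restrict (Ioi (0 : ℝ))),
        AbelEquationAt n k nievergeltPsi w r := by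
  rintro ⟨w, hw⟩
  have hk2 : (2 : ℝ) ≤ k := by exact_mod_cast hk
  have he : 0 ≤ (k : ℝ) / 2 - 1 := by linarith
  have hc := abelConst_pos (by omega : 0 < k) hkn
  rw [ae_restrict_iff' measurableSet_Ioi] at hw
  set g : ℝ → ℝ := fun s => s ^ ((n : ℝ) - k - 1) * w s with hg
  -- A point beyond `2` gives integrability of `g` on `(0, 2)`.
  obtain ⟨r₀, hr₀, hr₀e⟩ : ∃ r₀ : ℝ, 2 < r₀ ∧ IntegrableOn (abelIntegrand n k w r₀) (Ioo 0 r₀) := by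
    have hf : ∃ᵐ r : ℝ, r ∈ Ioi (2 : ℝ) := by
      rw [Filter.frequently_iff]
      intro U hU
      by_contra h
      push Not at h
      have h0 : volume (Ioi (2 : ℝ)) = 0 := measure_mono_null (fun x hx hxU => h x hxU hx) hU
      simp at h0
    obtain ⟨r, hr, hrw⟩ := (hf.and_eventually hw).exists
    have hr' : 2 < r := hr
    exact ⟨r, hr, (hrw (by linarith : (0 : ℝ) < r)).1⟩
  have hgi : IntegrableOn g (Ioo 0 2) := by
    have h2 : IntegrableOn (abelIntegrand n k w r₀) (Ioo 0 2) :=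
      hr₀e.mono_set (Ioo_subset_Ioo_right hr₀.le)
    have hd : ContinuousOn (fun s : ℝ => ((r₀ ^ 2 - s ^ 2) ^ ((k : ℝ) / 2 - 1))⁻¹) (Icc 0 2) := by
      refine ContinuousOn.inv₀ (ContinuousOn.rpow_const (by fun_prop) fun _ _ => Or.inr he)
        fun s hs => ?_
      have : 0 < r₀ ^ 2 - s ^ 2 := by nlinarith [hs.1, hs.2]
      exact (Real.rpow_pos_of_pos this _).ne'
    have h3 := (h2.mul_continuousOn_of_subset hd measurableSet_Ioo isCompact_Icc Ioo_subset_Icc_self)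
    refine h3.congr_fun (fun s hs => ?_) measurableSet_Ioo
    have : 0 < r₀ ^ 2 - s ^ 2 := by nlinarith [hs.1, hs.2]
    have := Real.rpow_pos_of_pos this ((k : ℝ) / 2 - 1)
    simp only [abelIntegrand, hg]
    field_simp
  -- The moving endpoint is put into an indicator, so that the domain is fixed and dominated
  -- convergence applies.
  set G : ℝ → ℝ := fun r => ∫ s in Ioo (0 : ℝ) 2,
    (Iio r).indicator (fun s => g s * (r ^ 2 - s ^ 2) ^ ((k : ℝ) / 2 - 1)) s with hG
  have hGcont : ContinuousAt G 1 := by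
    have hnear : ∀ᶠ r : ℝ in 𝓝 1, r ∈ Ioo (0 : ℝ) 2 := Ioo_mem_nhds one_pos one_lt_two
    -- For `0 < s < r < 2` the base satisfies `r² - s² ≤ 4`, and the exponent is nonnegative because
    -- `k ≥ 2`.
    refine continuousAt_of_dominated (bound := fun s => ‖g s‖ * 4 ^ ((k : ℝ) / 2 - 1)) ?_ ?_ ?_ ?_
    · refine Eventually.of_forall fun r => AEStronglyMeasurable.indicator ?_ measurableSet_Iio
      exact hgi.1.mul (Measurable.aestronglyMeasurable (by fun_prop))
    · filter_upwards [hnear] with r hr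
      filter_upwards [ae_restrict_mem measurableSet_Ioo] with s hs
      by_cases hsr : s ∈ Iio r
      · have hsr' : s < r := hsr
        have h0 : 0 ≤ r ^ 2 - s ^ 2 := by nlinarith [hs.1]
        rw [indicator_of_mem hsr, norm_mul, Real.norm_of_nonneg (Real.rpow_nonneg h0 _)]
        gcongr
        nlinarith [hr.2, hr.1, hs.1]
      · rw [indicator_of_notMem hsr, norm_zero]
        positivity
    · exact hgi.norm.mul_const _
    -- Only at `s = 1` can the indicator jump as `r` passes `1`; that point is null.
    · filter_upwards [(compl_mem_ae_iff.2 (by simp) :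
        ({1}ᶜ : Set ℝ) ∈ ae (volume.restrict (Ioo (0 : ℝ) 2)))] with s hs
      have hs1 : s ≠ 1 := hs
      have hcont : ContinuousAt (fun r : ℝ => g s * (r ^ 2 - s ^ 2) ^ ((k : ℝ) / 2 - 1)) 1 :=
        ContinuousAt.mul continuousAt_const
          (ContinuousAt.rpow_const (by fun_prop) (Or.inr he))
      rcases lt_or_gt_of_ne hs1 with h | h
      · refine hcont.congr ?_
        filter_upwards [Ioi_mem_nhds h] with r hr
        rw [indicator_of_mem (show s ∈ Iio r from hr)]
      · refine (continuousAt_const (y := (0 : ℝ))).congr ?_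
        filter_upwards [Iio_mem_nhds h] with r hr
        rw [indicator_of_notMem]
        exact not_lt.2 (le_of_lt (show r < s from hr))
  have hGeq : ∀ᵐ r : ℝ, r ∈ Ioo (0 : ℝ) 2 →
      abelConst n k * r ^ (2 - (n : ℝ)) * G r = nievergeltPsi r := by
    filter_upwards [hw] with r hr hr2
    rw [← (hr hr2.1).2, hG]
    simp only
    rw [integral_indicator measurableSet_Iio, Measure.restrict_restrict measurableSet_Iio,
      show Iio r ∩ Ioo 0 2 = Ioo 0 r from by
        ext s
        exact ⟨fun h => ⟨h.2.1, h.1⟩, fun h => ⟨h.2, h.1, h.2.trans hr2.2⟩⟩]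
    rfl
  have hL : ContinuousAt (fun r : ℝ => abelConst n k * r ^ (2 - (n : ℝ)) * G r) 1 :=
    (continuousAt_const.mul (Real.continuousAt_rpow_const 1 _ (Or.inl one_ne_zero))).mul hGcont
  have hfreq : ∀ {a b : ℝ}, a < b → Ioo a b ⊆ Ioo 0 2 → ∃ r ∈ Ioo a b,
      abelConst n k * r ^ (2 - (n : ℝ)) * G r = nievergeltPsi r := by
    intro a b hab hsub
    by_contra h
    push Not at h
    have h0 : volume (Ioo a b) = 0 := by
      refine measure_mono_null (fun x hx => ?_) (ae_iff.1 hGeq)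
      simp only [mem_ofPred_eq]
      exact fun hxU => h x hx (hxU (hsub hx))
    simp only [Real.volume_Ioo, ENNReal.ofReal_eq_zero] at h0
    linarith
  -- The equation holds at points arbitrarily close to `1` on both sides, with values `1` and `0`.
  -- Both cannot lie strictly within `1/2` of one number.
  obtain ⟨δ, hδ, hball⟩ := Metric.continuousAt_iff.1 hL (1 / 2) (by norm_num)
  set ε := min δ 1 with hε
  have hε0 : 0 < ε := lt_min hδ one_pos
  have hε1 : ε ≤ 1 := min_le_right _ _
  have hεδ : ε ≤ δ := min_le_left _ _
  obtain ⟨r, hr, hr1⟩ := hfreq (by linarith : 1 - ε < 1)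
    fun x hx => ⟨by linarith [hx.1], by linarith [hx.2]⟩
  obtain ⟨q, hq, hq1⟩ := hfreq (by linarith : 1 < 1 + ε)
    fun x hx => ⟨by linarith [hx.1], by linarith [hx.2]⟩
  have b1 := hball (x := r) (by rw [Real.dist_eq, abs_lt]; constructor <;> linarith [hr.1, hr.2])
  have b2 := hball (x := q) (by rw [Real.dist_eq, abs_lt]; constructor <;> linarith [hq.1, hq.2])
  rw [hr1, nievergeltPsi, indicator_of_mem (show r ∈ Icc (0 : ℝ) 1 from
    ⟨by linarith [hr.1], hr.2.le⟩), Real.dist_eq, abs_lt] at b1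
  rw [hq1, nievergeltPsi, indicator_of_notMem (fun h : q ∈ Icc (0 : ℝ) 1 =>
    absurd h.2 (not_le.2 hq.1)), Real.dist_eq, abs_lt] at b2
  linarith [b1.1, b1.2, b2.1, b2.2]

end Jump

/-! ### Ball means and their limits -/

section Averages

/-- Minkowski's integral inequality over a finite measure: Hölder in `y` at each `x`, then Tonelli.
-/
lemma eLpNorm_integral_le {X Y F : Type*} [MeasurableSpace X] [MeasurableSpace Y]
    [NormedAddCommGroup F] [NormedSpace ℝ F] {μ : Measure X} {ν : Measure Y} [SFinite μ]
    [IsFiniteMeasure ν] {p : ℝ≥0∞} (hp1 : 1 ≤ p) (hp : p ≠ ∞) {f : X → Y → F}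
    (hf : StronglyMeasurable (Function.uncurry f)) {M : ℝ≥0∞}
    (hM : ∀ᵐ y ∂ν, eLpNorm (fun x => f x y) p μ ≤ M) :
    eLpNorm (fun x => ∫ y, f x y ∂ν) p μ ≤ ν univ * M := by
  have hp0 : p ≠ 0 := (one_pos.trans_le hp1).ne'
  have hP : 0 < p.toReal := ENNReal.toReal_pos hp0 hp
  have hP1 : 1 ≤ p.toReal := by simpa using ENNReal.toReal_mono hp hp1
  have hpt : ∀ x, ‖∫ y, f x y ∂ν‖ₑ ^ p.toReal ≤
      ν univ ^ (p.toReal - 1) * ∫⁻ y, ‖f x y‖ₑ ^ p.toReal ∂ν := by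
    intro x
    have hfx : AEStronglyMeasurable (f x) ν :=
      (hf.comp_measurable measurable_prodMk_left).aestronglyMeasurable
    have h := eLpNorm_le_eLpNorm_mul_rpow_measure_univ hp1 hfx
    rw [eLpNorm_one_eq_lintegral_enorm, eLpNorm_eq_lintegral_rpow_enorm_toReal hp0 hp] at h
    calc ‖∫ y, f x y ∂ν‖ₑ ^ p.toReal
        ≤ (∫⁻ y, ‖f x y‖ₑ ∂ν) ^ p.toReal := by
          gcongr
          exact enorm_integral_le_lintegral_enorm _
      _ ≤ _ := ENNReal.rpow_le_rpow h hP.le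
      _ = _ := by
        rw [ENNReal.mul_rpow_of_nonneg _ _ hP.le, ← ENNReal.rpow_mul, ← ENNReal.rpow_mul, mul_comm]
        congr 2
        · simp
          field_simp
        · rw [one_div_mul_cancel hP.ne', ENNReal.rpow_one]
  have hmeas : Measurable (Function.uncurry fun x y => ‖f x y‖ₑ ^ p.toReal) :=
    hf.enorm.pow_const _
  rw [eLpNorm_eq_lintegral_rpow_enorm_toReal hp0 hp, one_div, ENNReal.rpow_inv_le_iff hP]
  calc ∫⁻ x, ‖∫ y, f x y ∂ν‖ₑ ^ p.toReal ∂μ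
      ≤ ∫⁻ x, ν univ ^ (p.toReal - 1) * ∫⁻ y, ‖f x y‖ₑ ^ p.toReal ∂ν ∂μ := lintegral_mono hpt
    _ = ν univ ^ (p.toReal - 1) * ∫⁻ y, ∫⁻ x, ‖f x y‖ₑ ^ p.toReal ∂μ ∂ν := by
      rw [lintegral_const_mul _ hmeas.lintegral_prod_right, lintegral_lintegral_swap hmeas.aemeasurable]
    _ ≤ ν univ ^ (p.toReal - 1) * ∫⁻ _, M ^ p.toReal ∂ν := by
      gcongr _ * ?_
      refine lintegral_mono_ae ?_
      filter_upwards [hM] with y hy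
      rwa [eLpNorm_eq_lintegral_rpow_enorm_toReal hp0 hp, one_div, ENNReal.rpow_inv_le_iff hP] at hy
    _ = (ν univ * M) ^ p.toReal := by
      rw [lintegral_const, ENNReal.mul_rpow_of_nonneg _ _ hP.le, mul_comm (M ^ _), ← mul_assoc]
      congr 1
      by_cases h0 : ν univ = 0
      · rw [h0, mul_zero, ENNReal.zero_rpow_of_pos hP]
      · nth_rewrite 2 [← ENNReal.rpow_one (ν univ)]
        rw [← ENNReal.rpow_add _ _ h0 (measure_ne_top _ _)]
        congr 1
        ring

lemma tendsto_eLpNorm_translate_sub {n : ℕ} {F : Type*} [NormedAddCommGroup F] {p : ℝ≥0∞}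
    (hp1 : 1 ≤ p) (hp : p ≠ ∞) {f : Euc n → F} (hf : MemLp f p volume) :
    Tendsto (fun h : Euc n => eLpNorm (fun x => f (x - h) - f x) p volume) (𝓝 0) (𝓝 0) := by
  have : Fact (1 ≤ p) := ⟨hp1⟩
  have : Fact (p ≠ ∞) := ⟨hp⟩
  -- The element `DomAddAct.mk c` acts by `f ↦ f(c + ·)`, hence the sign. The translation action on
  -- `Lp` is continuous for finite `p`.
  have hc : Continuous fun h : Euc n => DomAddAct.mk (-h) +ᵥ hf.toLp f := by
    have : Continuous fun h : Euc n => DomAddAct.mk (-h) :=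
      DomAddAct.continuous_mk.comp continuous_neg
    fun_prop
  have ht := (hc.tendsto 0).edist (tendsto_const_nhds (x := hf.toLp f))
  simp only [neg_zero] at ht
  rw [show DomAddAct.mk (0 : Euc n) = 0 from rfl, zero_vadd, edist_self] at ht
  refine ht.congr fun h => ?_
  rw [DomAddAct.mk_vadd_toLp, Lp.edist_toLp_toLp]
  refine eLpNorm_congr_ae (Eventually.of_forall fun x => ?_)
  simp only [Pi.sub_apply, vadd_eq_add]
  rw [neg_add_eq_sub]

instance {n : ℕ} (x : Euc n) (r : ℝ) :
    IsFiniteMeasure ((volume : Measure (Euc n)).restrict (Metric.closedBall x r)) :=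
  ⟨by simpa using measure_closedBall_lt_top⟩

lemma eLpNorm_comp_sub {n : ℕ} {F : Type*} [NormedAddCommGroup F] {p : ℝ≥0∞} {f : Euc n → F} (hf : AEStronglyMeasurable f volume)
    (h : Euc n) : eLpNorm (fun x => f (x - h)) p volume = eLpNorm f p volume :=
  eLpNorm_comp_measurePreserving hf (measurePreserving_sub_right volume h)

lemma MeasureTheory.MemLp.integrableOn_closedBall {n : ℕ} {F : Type*} [NormedAddCommGroup F] {p : ℝ≥0∞} (hp1 : 1 ≤ p) {f : Euc n → F}
    (hf : MemLp f p volume) (x : Euc n) (r : ℝ) : IntegrableOn f (Metric.closedBall x r) :=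
  (hf.restrict _).integrable hp1

lemma integrableOn_comp_sub_smul {n : ℕ} {F : Type*} [NormedAddCommGroup F] {a : ℝ} (ha : 0 < a) {f : Euc n → F} {x : Euc n}
    (hf : IntegrableOn f (Metric.closedBall x a)) :
    IntegrableOn (fun y => f (x - a • y)) (Metric.closedBall (0 : Euc n) 1) := by
  rw [← integrable_indicator_iff measurableSet_closedBall] at hf ⊢
  have h1 := (hf.comp_sub_left x).comp_smul ha.ne'
  refine h1.congr (Eventually.of_forall fun y => ?_)
  have hiff : y ∈ Metric.closedBall (0 : Euc n) 1 ↔ x - a • y ∈ Metric.closedBall x a := by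
    rw [mem_closedBall_zero_iff, Metric.mem_closedBall, dist_eq_norm, sub_sub_cancel_left,
      norm_neg, norm_smul, Real.norm_of_nonneg ha.le, mul_le_iff_le_one_right ha]
  by_cases hy : y ∈ Metric.closedBall (0 : Euc n) 1
  · simp only [indicator_of_mem hy, indicator_of_mem (hiff.1 hy)]
  · simp only [indicator_of_notMem hy, indicator_of_notMem (fun h => hy (hiff.2 h))]

variable {n : ℕ} {F : Type*} [NormedAddCommGroup F] [NormedSpace ℝ F]

/-- The operator `f ↦ ∫ f(x - a y) ψ(|y|) dy` for Nievergelt's `ψ`. -/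
noncomputable def ballMean (a : ℝ) (f : Euc n → F) (x : Euc n) : F :=
  ∫ y : Euc n, nievergeltPsi ‖y‖ • f (x - a • y)

lemma nievergeltPsi_norm_smul (y : Euc n) (c : F) :
    nievergeltPsi ‖y‖ • c = (Metric.closedBall (0 : Euc n) 1).indicator (fun _ => c) y := by
  by_cases hy : y ∈ Metric.closedBall (0 : Euc n) 1
  · rw [indicator_of_mem hy, nievergeltPsi, indicator_of_mem, one_smul]
    exact ⟨norm_nonneg y, mem_closedBall_zero_iff.1 hy⟩
  · rw [indicator_of_notMem hy, nievergeltPsi, indicator_of_notMem, zero_smul]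
    exact fun h => hy (mem_closedBall_zero_iff.2 h.2)

lemma ballMean_eq_setIntegral (a : ℝ) (f : Euc n → F) (x : Euc n) :
    ballMean a f x = ∫ y in Metric.closedBall (0 : Euc n) 1, f (x - a • y) := by
  rw [ballMean, ← integral_indicator measurableSet_closedBall]
  refine integral_congr_ae (Eventually.of_forall fun y => ?_)
  simp only [nievergeltPsi_norm_smul]
  by_cases hy : y ∈ Metric.closedBall (0 : Euc n) 1
  · rw [indicator_of_mem hy, indicator_of_mem hy]
  · rw [indicator_of_notMem hy, indicator_of_notMem hy]

lemma nievergeltLambda_eq (n : ℕ) :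
    nievergeltLambda n = (volume : Measure (Euc n)).real (Metric.closedBall 0 1) := by
  have h := ballMean_eq_setIntegral (n := n) 0 (fun _ => (1 : ℝ)) 0
  simp only [ballMean, smul_eq_mul, mul_one] at h
  rw [nievergeltLambda, h]
  simp

lemma ballMean_eq_integral_div {a : ℝ} (ha : 0 < a) (f : Euc n → F) (x : Euc n) :
    ballMean a f x = (a ^ n)⁻¹ • ∫ y : Euc n, nievergeltPsi ‖a⁻¹ • (x - y)‖ • f y := by
  have h1 := integral_sub_left_eq_self
    (fun y : Euc n => nievergeltPsi ‖a⁻¹ • (x - y)‖ • f y) volume x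
  simp only [sub_sub_cancel] at h1
  have h2 := Measure.integral_comp_smul (volume : Measure (Euc n))
    (fun y => nievergeltPsi ‖a⁻¹ • y‖ • f (x - y)) a
  simp only [inv_smul_smul₀ ha.ne'] at h2
  rw [ballMean, h2, h1, finrank_euclideanSpace_fin, abs_of_pos (by positivity)]

/-- This is the form to which Lebesgue differentiation applies. -/
lemma ballMean_eq_average {a : ℝ} (ha : 0 < a) (f : Euc n → F) (x : Euc n) :
    ballMean a f x = nievergeltLambda n • ⨍ y in Metric.closedBall x a, f y := by
  have hset : ∫ y : Euc n, nievergeltPsi ‖a⁻¹ • (x - y)‖ • f y =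
      ∫ y in Metric.closedBall x a, f y := by
    rw [← integral_indicator Metric.isClosed_closedBall.measurableSet]
    refine integral_congr_ae (Eventually.of_forall fun y => ?_)
    simp only [nievergeltPsi_norm_smul]
    have hiff : a⁻¹ • (x - y) ∈ Metric.closedBall (0 : Euc n) 1 ↔ y ∈ Metric.closedBall x a := by
      rw [mem_closedBall_zero_iff, norm_smul, norm_inv, Real.norm_of_nonneg ha.le,
        Metric.mem_closedBall', dist_eq_norm, inv_mul_le_iff₀ ha, mul_one]
    by_cases hy : y ∈ Metric.closedBall x a
    · rw [indicator_of_mem hy, indicator_of_mem (hiff.2 hy)]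
    · rw [indicator_of_notMem hy, indicator_of_notMem (fun h => hy (hiff.1 h))]
  rw [ballMean_eq_integral_div ha, hset, setAverage_eq, smul_smul, nievergeltLambda_eq]
  congr 1
  have hb : (volume : Measure (Euc n)).real (Metric.closedBall x a) =
      a ^ n * (volume : Measure (Euc n)).real (Metric.closedBall 0 1) := by
    rw [measureReal_def, Measure.addHaar_closedBall' _ _ ha.le, finrank_euclideanSpace_fin,
      ENNReal.toReal_mul, ENNReal.toReal_ofReal (by positivity), measureReal_def]
  have hpos : 0 < (volume : Measure (Euc n)).real (Metric.closedBall 0 1) :=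
    ENNReal.toReal_pos (Metric.measure_closedBall_pos _ _ one_pos).ne'
      measure_closedBall_lt_top.ne
  rw [hb, mul_inv, mul_left_comm, mul_inv_cancel₀ hpos.ne', mul_one]

lemma ballMean_congr_ae {a : ℝ} (ha : 0 < a) {f g : Euc n → F} (h : f =ᵐ[volume] g) :
    ballMean a f = ballMean a g := by
  ext x
  rw [ballMean_eq_integral_div ha, ballMean_eq_integral_div ha]
  congr 1
  refine integral_congr_ae ?_
  filter_upwards [h] with y hy
  rw [hy]

lemma stronglyMeasurable_ballMean (a : ℝ) {f : Euc n → F} (hf : StronglyMeasurable f) :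
    StronglyMeasurable (ballMean a f) := by
  have : ballMean a f = fun x => ∫ y in Metric.closedBall (0 : Euc n) 1, f (x - a • y) :=
    funext fun x => ballMean_eq_setIntegral a f x
  rw [this]
  refine StronglyMeasurable.integral_prod_right (f := fun x y => f (x - a • y)) ?_
  exact hf.comp_measurable (g := fun q : Euc n × Euc n => q.1 - a • q.2) (by fun_prop)

lemma memLp_ballMean {p : ℝ≥0∞} (hp1 : 1 ≤ p) (hp : p ≠ ∞) {f : Euc n → F}
    (hf : MemLp f p volume) {a : ℝ} (ha : 0 < a) : MemLp (ballMean a f) p volume := by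
  obtain ⟨g, hg, hfg⟩ := hf.1
  have hgL : MemLp g p volume := (memLp_congr_ae hfg).1 hf
  rw [ballMean_congr_ae ha hfg]
  refine ⟨(stronglyMeasurable_ballMean a hg).aestronglyMeasurable, ?_⟩
  have h := eLpNorm_integral_le (μ := volume) (M := eLpNorm g p volume)
    (ν := (volume : Measure (Euc n)).restrict (Metric.closedBall 0 1)) hp1 hp
    (f := fun x y => g (x - a • y))
    (hg.comp_measurable (g := fun q : Euc n × Euc n => q.1 - a • q.2) (by fun_prop))
    (Eventually.of_forall fun y => (eLpNorm_comp_sub hg.aestronglyMeasurable _).le)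
  simp only [← ballMean_eq_setIntegral] at h
  exact h.trans_lt (ENNReal.mul_lt_top (measure_lt_top _ _) hgL.2)

lemma ballMean_sub_eq {p : ℝ≥0∞} [CompleteSpace F] (hp1 : 1 ≤ p) {f : Euc n → F}
    (hf : MemLp f p volume) {a : ℝ} (ha : 0 < a) (x : Euc n) :
    ballMean a f x - nievergeltLambda n • f x =
      ∫ y in Metric.closedBall (0 : Euc n) 1, (f (x - a • y) - f x) := by
  rw [integral_sub (integrableOn_comp_sub_smul ha (hf.integrableOn_closedBall hp1 x a))
    (integrableOn_const measure_closedBall_lt_top.ne), ballMean_eq_setIntegral, setIntegral_const,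
    nievergeltLambda_eq]

/-- The error is the integral over the unit ball of `f(x - a y) - f(x)`. By Minkowski its norm is at
most the ball's volume times the largest translation error over shifts of length at most `a`. -/
lemma tendsto_eLpNorm_ballMean_sub {p : ℝ≥0∞} [CompleteSpace F] (hp1 : 1 ≤ p) (hp : p ≠ ∞)
    {f : Euc n → F} (hf : MemLp f p volume) :
    Tendsto (fun a : ℝ => eLpNorm (fun x => ballMean a f x - nievergeltLambda n • f x) p volume)
      (𝓝[>] 0) (𝓝 0) := by
  obtain ⟨g, hg, hfg⟩ := hf.1
  have hgL : MemLp g p volume := (memLp_congr_ae hfg).1 hf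
  set V : ℝ≥0∞ := (volume : Measure (Euc n)) (Metric.closedBall 0 1) with hV
  have hVt : V ≠ ∞ := measure_closedBall_lt_top.ne
  have key : ∀ ε : ℝ≥0∞, 0 < ε → ∀ᶠ a : ℝ in 𝓝[>] 0,
      eLpNorm (fun x => ballMean a f x - nievergeltLambda n • f x) p volume ≤ V * ε := by
    intro ε hε
    have ht := (tendsto_eLpNorm_translate_sub hp1 hp hgL).eventually (ge_mem_nhds hε)
    obtain ⟨δ, hδ, hball⟩ := Metric.eventually_nhds_iff.1 ht
    filter_upwards [Ioo_mem_nhdsGT hδ] with a ha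
    have e1 : eLpNorm (fun x => ballMean a f x - nievergeltLambda n • f x) p volume =
        eLpNorm (fun x => ∫ y in Metric.closedBall (0 : Euc n) 1, (g (x - a • y) - g x))
          p volume := by
      refine eLpNorm_congr_ae ?_
      filter_upwards [hfg] with x hx
      rw [ballMean_congr_ae ha.1 hfg, hx, ballMean_sub_eq hp1 hgL ha.1]
    rw [e1, hV, ← Measure.restrict_apply_univ]
    refine eLpNorm_integral_le (f := fun x y => g (x - a • y) - g x) hp1 hp ?_ ?_
    · exact (hg.comp_measurable (g := fun q : Euc n × Euc n => q.1 - a • q.2) (by fun_prop)).sub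
        (hg.comp_measurable measurable_fst)
    · filter_upwards [ae_restrict_mem measurableSet_closedBall] with y hy
      refine hball ?_
      rw [dist_zero_right, norm_smul, Real.norm_of_nonneg ha.1.le]
      have : ‖y‖ ≤ 1 := mem_closedBall_zero_iff.1 hy
      nlinarith [ha.1, ha.2, norm_nonneg y]
  rw [ENNReal.tendsto_nhds_zero]
  intro ε hε
  by_cases hεt : ε = ∞
  · simp [hεt]
  have hV1 : V + 1 ≠ ∞ := by finiteness
  filter_upwards [key (ε / (V + 1)) (ENNReal.div_pos hε.ne' hV1)] with a ha
  refine ha.trans ?_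
  calc V * (ε / (V + 1)) ≤ (V + 1) * (ε / (V + 1)) := by gcongr; exact le_self_add
    _ = ε := ENNReal.mul_div_cancel (by simp) hV1

lemma ae_tendsto_ballMean {p : ℝ≥0∞} [CompleteSpace F] (hp1 : 1 ≤ p)
    {f : Euc n → F} (hf : MemLp f p volume) :
    ∀ᵐ x : Euc n, Tendsto (fun a : ℝ => ballMean a f x) (𝓝[>] 0)
      (𝓝 (nievergeltLambda n • f x)) := by
  filter_upwards [IsUnifLocDoublingMeasure.ae_tendsto_average volume
    (hf.locallyIntegrable hp1) 1] with x hx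
  have h := hx (fun _ : ℝ => x) (fun a : ℝ => a) (l := 𝓝[>] 0) tendsto_id (by
    filter_upwards [self_mem_nhdsWithin] with a ha
    exact Metric.mem_closedBall_self (by have : (0 : ℝ) < a := ha; linarith))
  refine (h.const_smul (nievergeltLambda n)).congr' ?_
  filter_upwards [self_mem_nhdsWithin] with a ha
  exact (ballMean_eq_average ha f x).symm

lemma tendstoUniformly_ballMean {p : ℝ≥0∞} [CompleteSpace F] (hp1 : 1 ≤ p)
    {f : Euc n → F} (hf : MemLp f p volume) (hc : Continuous f)
    (h0 : Tendsto f (cocompact (Euc n)) (𝓝 0)) :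
    TendstoUniformly (fun (a : ℝ) (x : Euc n) => ballMean a f x)
      (fun x => nievergeltLambda n • f x) (𝓝[>] 0) := by
  have hu := hc.uniformContinuous_of_tendsto_cocompact h0
  rw [Metric.tendstoUniformly_iff]
  intro ε hε
  have hL : 0 ≤ nievergeltLambda n := by rw [nievergeltLambda_eq]; positivity
  obtain ⟨δ, hδ, hd⟩ := Metric.uniformContinuous_iff.1 hu (ε / (nievergeltLambda n + 1))
    (by positivity)
  filter_upwards [Ioo_mem_nhdsGT hδ] with a ha x
  rw [dist_eq_norm, norm_sub_rev, ballMean_sub_eq hp1 hf ha.1]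
  have hb := norm_setIntegral_le_of_norm_le_const (μ := volume) (s := Metric.closedBall (0 : Euc n) 1)
    (f := fun y => f (x - a • y) - f x) (C := ε / (nievergeltLambda n + 1))
    measure_closedBall_lt_top (fun y hy => by
      rw [← dist_eq_norm]
      refine (hd ?_).le
      rw [dist_eq_norm, sub_sub_cancel_left, norm_neg, norm_smul, Real.norm_of_nonneg ha.1.le]
      have : ‖y‖ ≤ 1 := mem_closedBall_zero_iff.1 hy
      nlinarith [ha.1, ha.2, norm_nonneg y])
  rw [← nievergeltLambda_eq] at hb
  refine hb.trans_lt ?_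
  rw [div_mul_eq_mul_div, div_lt_iff₀ (by positivity)]
  nlinarith

end Averages

/-! ### Lines, distances and the X-ray transform in coordinates -/

section Lines

variable {n : ℕ}

lemma measurable_dirOfUnit (n : ℕ) : Measurable (dirOfUnit n) := fun _ hs => hs

/-- The quotient σ-algebra is the largest one making `dirOfUnit` measurable, so measurability on
`LineDir n` is always tested on the sphere. -/
lemma measurable_of_comp_dirOfUnit {α : Type*} [MeasurableSpace α] {f : LineDir n → α}
    (hf : Measurable fun θ => f (dirOfUnit n θ)) : Measurable f := fun _ hs => hf hs

lemma dirMeasure_eq_map (n : ℕ) : dirMeasure n = (sphereProb (Euc n)).map (dirOfUnit n) := rfl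

/-- The length of the component of `y` perpendicular to the direction `ζ`. -/
noncomputable def perpDist (ζ : LineDir n) (y : Euc n) : ℝ := ‖ζ.1ᗮ.starProjection y‖

lemma perpDist_smul (ζ : LineDir n) {c : ℝ} (hc : 0 ≤ c) (y : Euc n) :
    perpDist ζ (c • y) = c * perpDist ζ y := by
  rw [perpDist, map_smul, norm_smul, Real.norm_of_nonneg hc, perpDist]

lemma starProjection_orthogonal_of_mem {K : Submodule ℝ (Euc n)} {y : Euc n} (hy : y ∈ K) :
    Kᗮ.starProjection y = 0 := by
  rw [Submodule.starProjection_orthogonal_val, Submodule.starProjection_eq_self_iff.2 hy, sub_self]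

lemma perpDist_sub_of_mem (ζ : LineDir n) (y : Euc n) {x : Euc n} (hx : x ∈ ζ.1) :
    perpDist ζ (y - x) = perpDist ζ y := by
  rw [perpDist, map_sub, starProjection_orthogonal_of_mem hx, sub_zero, perpDist]

lemma perpDist_dirOfUnit (θ : Metric.sphere (0 : Euc n) 1) (y : Euc n) :
    perpDist (dirOfUnit n θ) y = √(‖y‖ ^ 2 - inner ℝ (θ : Euc n) y ^ 2) := by
  have hθ : ‖(θ : Euc n)‖ = 1 := norm_eq_of_mem_sphere θ
  have h := Submodule.norm_sq_eq_add_norm_sq_starProjection (𝕜 := ℝ) y (Submodule.span ℝ {(θ : Euc n)})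
  rw [Submodule.starProjection_unit_singleton ℝ hθ, norm_smul, hθ, mul_one, Real.norm_eq_abs,
    sq_abs] at h
  rw [h, add_sub_cancel_left, Real.sqrt_sq (norm_nonneg _)]
  rfl

lemma measurable_perpDist (ζ : LineDir n) : Measurable (perpDist ζ) :=
  (ζ.1ᗮ.starProjection.continuous.norm).measurable

/-- The foot of the perpendicular attains the distance, and the orthogonal projection does not
increase norms. -/
lemma infDist_points (τ : Line n) (x : Euc n) :
    Metric.infDist x τ.points = perpDist τ.1 (x - τ.2) := by
  have hne : τ.points.Nonempty := ⟨_, 0, rfl⟩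
  refine le_antisymm ?_ ((Metric.le_infDist hne).2 ?_)
  · have hmem : τ.1.1.starProjection (x - τ.2) + (τ.2 : Euc n) ∈ τ.points :=
      ⟨⟨_, Submodule.starProjection_apply_mem _ _⟩, rfl⟩
    refine (Metric.infDist_le_dist_of_mem hmem).trans_eq ?_
    rw [dist_eq_norm, perpDist, Submodule.starProjection_orthogonal_val]
    congr 1
    abel
  · rintro _ ⟨x', rfl⟩
    rw [← perpDist_sub_of_mem τ.1 _ x'.2, dist_eq_norm, sub_sub, add_comm (τ.2 : Euc n)]
    exact Submodule.norm_starProjection_apply_le _ _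

lemma infDist_points_div (τ : Line n) (x : Euc n) {a : ℝ} (ha : 0 < a) :
    Metric.infDist x τ.points / a = perpDist τ.1 (a⁻¹ • (x - τ.2)) := by
  rw [infDist_points, perpDist_smul _ (by positivity), div_eq_inv_mul]

/-- The weight is constant along each line of direction `ζ`, so it can be moved inside the integral
defining `xray`. -/
lemma perpDist_smul_sub_add (ζ : LineDir n) (c : ℝ) (x u : Euc n) {x' : Euc n} (hx' : x' ∈ ζ.1) :
    perpDist ζ (c • (x - (x' + u))) = perpDist ζ (c • (x - u)) := by
  rw [← perpDist_sub_of_mem ζ (c • (x - u)) (ζ.1.smul_mem c hx')]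
  congr 1
  module

variable {𝕜 : Type*} [RCLike 𝕜]

lemma xray_dirOfUnit (f : Euc n → 𝕜) (θ : Metric.sphere (0 : Euc n) 1)
    (u : ((dirOfUnit n θ).1ᗮ : Submodule ℝ (Euc n))) :
    xray f ⟨dirOfUnit n θ, u⟩ = ∫ t : ℝ, f (t • (θ : Euc n) + u) := by
  have hθ : ‖(θ : Euc n)‖ = 1 := norm_eq_of_mem_sphere θ
  have h := (LinearIsometryEquiv.toSpanUnitSingleton (𝕜 := ℝ) (θ : Euc n) hθ).measurePreserving.integral_comp
    (LinearIsometryEquiv.toSpanUnitSingleton (𝕜 := ℝ) (θ : Euc n) hθ).toHomeomorph.measurableEmbedding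
    (fun x' => f ((x' : Euc n) + (u : Euc n)))
  simp only [LinearIsometryEquiv.toSpanUnitSingleton_apply] at h
  exact h.symm

lemma lintegral_span_unit (θ : Metric.sphere (0 : Euc n) 1)
    (G : (Submodule.span ℝ {(θ : Euc n)}) → ℝ≥0∞) :
    ∫⁻ x, G x = ∫⁻ t : ℝ, G ⟨t • (θ : Euc n), Submodule.smul_mem _ t
      (Submodule.mem_span_singleton_self _)⟩ := by
  have hθ : ‖(θ : Euc n)‖ = 1 := norm_eq_of_mem_sphere θ
  have h := (LinearIsometryEquiv.toSpanUnitSingleton (𝕜 := ℝ) (θ : Euc n) hθ).measurePreserving.lintegral_comp_emb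
    (LinearIsometryEquiv.toSpanUnitSingleton (𝕜 := ℝ) (θ : Euc n) hθ).toHomeomorph.measurableEmbedding G
  simp only [LinearIsometryEquiv.toSpanUnitSingleton_apply] at h
  exact h.symm

/-- This allows `f` to be replaced by a strongly measurable representative wherever joint
measurability is needed. -/
lemma ae_xray_eq_of_ae_eq {f g : Euc n → 𝕜} (h : f =ᵐ[volume] g) (ζ : LineDir n) :
    ∀ᵐ u : (ζ.1ᗮ : Submodule ℝ (Euc n)), xray f ⟨ζ, u⟩ = xray g ⟨ζ, u⟩ := by
  have h1 := (measurePreserving_orthoSplit ζ.1).quasiMeasurePreserving.ae_eq_comp h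
  rw [Measure.volume_eq_prod] at h1
  filter_upwards [Measure.ae_ae_of_ae_prod h1] with u hu
  refine integral_congr_ae ?_
  filter_upwards [hu] with x' hx'
  simpa only [Function.comp_apply, orthoSplit_apply] using hx'

end Lines

/-! ### Where `p < n` enters -/

section Decay

lemma memLp_decay {m : ℕ} {q : ℝ≥0∞} (hq0 : q ≠ 0)
    (hq : q ≠ ∞ → (m : ℝ) + 2 < q.toReal * (m + 1)) :
    MemLp (fun y : Euc (m + 2) => (1 + ‖y‖) ^ (-((m : ℝ) + 1))) q volume := by
  have hm : AEStronglyMeasurable (fun y : Euc (m + 2) => (1 + ‖y‖) ^ (-((m : ℝ) + 1))) volume :=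
    Measurable.aestronglyMeasurable (by fun_prop)
  by_cases hqt : q = ∞
  · rw [hqt]
    refine memLp_top_of_bound hm 1 (Eventually.of_forall fun y => ?_)
    rw [Real.norm_of_nonneg (by positivity)]
    exact Real.rpow_le_one_of_one_le_of_nonpos (by linarith [norm_nonneg y])
      (by linarith [(Nat.cast_nonneg m : (0 : ℝ) ≤ m)])
  · rw [← integrable_norm_rpow_iff hm hq0 hqt]
    have hi : Integrable (fun y : Euc (m + 2) => (1 + ‖y‖) ^ (-(q.toReal * (m + 1)))) volume := by
      refine integrable_one_add_norm ?_
      rw [finrank_euclideanSpace_fin]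
      push_cast
      exact hq hqt
    refine hi.congr (Eventually.of_forall fun y => ?_)
    simp only
    rw [Real.norm_of_nonneg (by positivity), ← Real.rpow_mul (by positivity)]
    congr 1
    ring

/-- Hölder's inequality. With `q` conjugate to `p`, the decay `(1 + ‖y‖)^{-(n-1)}` is in `L^q` once
`q (n-1) > n`, which amounts to `p < n`; for `p = 1` boundedness suffices. -/
lemma lintegral_decay_lt_top {m : ℕ} {F : Type*} [NormedAddCommGroup F] {p : ℝ≥0∞} (hp1 : 1 ≤ p)
    (hp : p < ((m + 2 : ℕ) : ℝ≥0∞)) {f : Euc (m + 2) → F} (hf : MemLp f p volume) :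
    ∫⁻ y, ENNReal.ofReal ((1 + ‖y‖) ^ (-((m : ℝ) + 1))) * ‖f y‖ₑ < ∞ := by
  have hpt : p ≠ ∞ := (hp.trans_le le_top).ne
  have hpr : p.toReal < m + 2 := by
    have := (ENNReal.toReal_lt_toReal hpt (by simp)).2 hp
    rw [ENNReal.toReal_natCast] at this
    exact_mod_cast this
  have hconj := ENNReal.HolderConjugate.conjExponent hp1
  have hq : MemLp (fun y : Euc (m + 2) => (1 + ‖y‖) ^ (-((m : ℝ) + 1))) p.conjExponent volume := by
    refine memLp_decay (ENNReal.HolderConjugate.ne_zero p.conjExponent p) fun hqt => ?_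
    have hr : Real.HolderConjugate p.toReal p.conjExponent.toReal :=
      ENNReal.HolderConjugate.toReal_of_ne_top hpt hqt
    rw [hr.conjugate_eq, div_mul_eq_mul_div, lt_div_iff₀ (by linarith [hr.lt])]
    nlinarith [(Nat.cast_nonneg m : (0 : ℝ) ≤ m)]
  have hi := hq.integrable_mul hf.norm
  have := hi.2
  refine lt_of_eq_of_lt (lintegral_congr fun y => ?_) this
  rw [Pi.mul_apply, enorm_mul, enorm_norm, Real.enorm_of_nonneg (by positivity)]

end Decay

/-! ### Fubini and the inversion formula -/

section Inversion

variable {m : ℕ} {𝕜 : Type*} [RCLike 𝕜]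

/-- The integrand of the wavelet-like transform, unfolded to a function of the point `y`. -/
noncomputable def pointKernel (a : ℝ) (f : Euc (m + 2) → 𝕜) (x : Euc (m + 2))
    (ζ : LineDir (m + 2)) (y : Euc (m + 2)) : 𝕜 :=
  xrayW (m + 2) (perpDist ζ (a⁻¹ • (x - y))) • f y

lemma pointKernel_dirOfUnit (a : ℝ) (f : Euc (m + 2) → 𝕜) (x y : Euc (m + 2))
    (θ : Metric.sphere (0 : Euc (m + 2)) 1) :
    pointKernel a f x (dirOfUnit _ θ) y =
      xrayW (m + 2) (√(‖a⁻¹ • (x - y)‖ ^ 2 - inner ℝ (θ : Euc (m + 2)) (a⁻¹ • (x - y)) ^ 2)) • f y := by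
  rw [pointKernel, perpDist_dirOfUnit]

lemma pointKernel_congr_ae (a : ℝ) {f g : Euc (m + 2) → 𝕜} (h : f =ᵐ[volume] g)
    (x : Euc (m + 2)) (ζ : LineDir (m + 2)) :
    pointKernel a f x ζ =ᵐ[volume] pointKernel a g x ζ := by
  filter_upwards [h] with y hy
  rw [pointKernel, hy, pointKernel]

lemma measurable_xrayW_perp (a : ℝ) (x : Euc (m + 2)) :
    Measurable fun q : Metric.sphere (0 : Euc (m + 2)) 1 × Euc (m + 2) =>
      xrayW (m + 2) (√(‖a⁻¹ • (x - q.2)‖ ^ 2 -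
        inner ℝ (q.1 : Euc (m + 2)) (a⁻¹ • (x - q.2)) ^ 2)) := by
  refine (measurable_xrayW m).comp ?_
  fun_prop

lemma stronglyMeasurable_pointKernel (a : ℝ) {f : Euc (m + 2) → 𝕜} (hf : StronglyMeasurable f)
    (x : Euc (m + 2)) :
    StronglyMeasurable (Function.uncurry fun (θ : Metric.sphere (0 : Euc (m + 2)) 1) y =>
      pointKernel a f x (dirOfUnit _ θ) y) := by
  simp only [pointKernel_dirOfUnit]
  exact (measurable_xrayW_perp a x).stronglyMeasurable.smul (hf.comp_measurable measurable_snd)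

lemma aestronglyMeasurable_pointKernel (a : ℝ) {f : Euc (m + 2) → 𝕜}
    (hf : AEStronglyMeasurable f volume) (x : Euc (m + 2)) (ζ : LineDir (m + 2)) :
    AEStronglyMeasurable (pointKernel a f x ζ) volume := by
  refine AEStronglyMeasurable.smul (Measurable.aestronglyMeasurable ?_) hf
  exact (measurable_xrayW m).comp ((measurable_perpDist ζ).comp (by fun_prop))

lemma waveletIntegrand_eq_smul (f : Euc (m + 2) → 𝕜) {a : ℝ} (ha : 0 < a) (x : Euc (m + 2))
    (ζ : LineDir (m + 2)) (u : (ζ.1ᗮ : Submodule ℝ (Euc (m + 2)))) :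
    waveletIntegrand (xrayW (m + 2)) a (xray f) x ⟨ζ, u⟩ =
      xrayW (m + 2) (perpDist ζ (a⁻¹ • (x - u))) • xray f ⟨ζ, u⟩ :=
  congrArg (fun c => xrayW (m + 2) c • xray f ⟨ζ, u⟩)
    (infDist_points_div (⟨ζ, u⟩ : Line (m + 2)) x ha)

lemma waveletIntegrand_eq (f : Euc (m + 2) → 𝕜) {a : ℝ} (ha : 0 < a) (x : Euc (m + 2))
    (ζ : LineDir (m + 2)) (u : (ζ.1ᗮ : Submodule ℝ (Euc (m + 2)))) :
    waveletIntegrand (xrayW (m + 2)) a (xray f) x ⟨ζ, u⟩ =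
      ∫ x' : ζ.1, pointKernel a f x ζ ((x' : Euc (m + 2)) + u) := by
  rw [waveletIntegrand_eq_smul f ha]
  change _ • ∫ x' : ζ.1, f ((x' : Euc (m + 2)) + u) = _
  rw [← integral_smul]
  refine integral_congr_ae (Eventually.of_forall fun x' => ?_)
  simp only [pointKernel, perpDist_smul_sub_add ζ _ x _ x'.2]

/-- By Tonelli the direction average of `|w|` is taken first; its decay in `(x - y)/a` is converted
into decay in `y`, to which Hölder applies. -/
lemma lintegral_sphere_pointKernel_lt_top {p : ℝ≥0∞} (hp1 : 1 ≤ p) (hp : p < ((m + 2 : ℕ) : ℝ≥0∞))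
    {f : Euc (m + 2) → 𝕜} (hfm : StronglyMeasurable f) (hf : MemLp f p volume) {a : ℝ} (ha : 0 < a)
    (x : Euc (m + 2)) :
    ∫⁻ θ, ∫⁻ y, ‖pointKernel a f x (dirOfUnit _ θ) y‖ₑ ∂volume ∂(sphereProb (Euc (m + 2))) < ∞ := by
  rw [lintegral_lintegral_swap (stronglyMeasurable_pointKernel a hfm x).enorm.aemeasurable]
  -- Chosen so that `1 + ‖y‖ ≤ C (1 + ‖x - y‖ / a)`.
  set C : ℝ := 1 + ‖x‖ + a with hC
  have hC0 : 0 < C := by positivity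
  have hpt : ∀ᵐ y : Euc (m + 2), ∫⁻ θ, ‖pointKernel a f x (dirOfUnit _ θ) y‖ₑ
        ∂(sphereProb (Euc (m + 2))) ≤ ENNReal.ofReal (2 ^ (m + 2) * C ^ ((m : ℝ) + 1)) *
          (ENNReal.ofReal ((1 + ‖y‖) ^ (-((m : ℝ) + 1))) * ‖f y‖ₑ) := by
    filter_upwards [compl_mem_ae_iff.2 (measure_singleton x)] with y hy
    have hxy : x - y ≠ 0 := sub_ne_zero.2 fun h => hy h.symm
    have hz : a⁻¹ • (x - y) ≠ 0 := smul_ne_zero (inv_ne_zero ha.ne') hxy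
    simp only [pointKernel_dirOfUnit, enorm_smul]
    rw [lintegral_mul_const' _ _ enorm_ne_top, ← mul_assoc, ← ENNReal.ofReal_mul (by positivity)]
    gcongr
    refine (lintegral_sphereProb_enorm_xrayW_le (by simp) hz).trans (ENNReal.ofReal_le_ofReal ?_)
    rw [mul_assoc]
    refine mul_le_mul_of_nonneg_left ?_ (by positivity)
    have h1 : 1 + ‖y‖ ≤ C * (1 + ‖a⁻¹ • (x - y)‖) := by
      rw [norm_smul, norm_inv, Real.norm_of_nonneg ha.le]
      have h2 : ‖y‖ ≤ ‖x‖ + ‖x - y‖ := by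
        have := norm_sub_le x (x - y)
        rwa [sub_sub_cancel] at this
      have h3 : a * (a⁻¹ * ‖x - y‖) = ‖x - y‖ := by field_simp
      have h4 : 0 ≤ a⁻¹ * ‖x - y‖ := by positivity
      nlinarith [norm_nonneg x]
    have hm : (0 : ℝ) ≤ (m : ℝ) + 1 := by positivity
    rw [Real.rpow_neg (by positivity), Real.rpow_neg (by positivity), ← div_eq_mul_inv,
      inv_le_comm₀ (by positivity) (by positivity), inv_div, div_le_iff₀ (by positivity),
      mul_comm, ← Real.mul_rpow (by positivity) (by positivity)]
    exact Real.rpow_le_rpow (by positivity) h1 hm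
  refine (lintegral_mono_ae hpt).trans_lt ?_
  rw [lintegral_const_mul' _ _ ENNReal.ofReal_ne_top]
  exact ENNReal.mul_lt_top ENNReal.ofReal_lt_top (lintegral_decay_lt_top hp1 hp hf)

/-- The absolute integral of the kernel over `ℝⁿ`, as a function of the direction. -/
noncomputable def absKernel (a : ℝ) (f : Euc (m + 2) → 𝕜) (x : Euc (m + 2)) (ζ : LineDir (m + 2)) :
    ℝ≥0∞ :=
  ∫⁻ y, ‖pointKernel a f x ζ y‖ₑ

lemma absKernel_congr_ae (a : ℝ) {f g : Euc (m + 2) → 𝕜} (h : f =ᵐ[volume] g)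
    (x : Euc (m + 2)) : absKernel a f x = absKernel a g x := by
  ext ζ
  refine lintegral_congr_ae ?_
  filter_upwards [pointKernel_congr_ae a h x ζ] with y hy
  rw [hy]

lemma measurable_absKernel (a : ℝ) {f : Euc (m + 2) → 𝕜} (hf : StronglyMeasurable f)
    (x : Euc (m + 2)) : Measurable (absKernel a f x) := by
  refine measurable_of_comp_dirOfUnit ?_
  exact Measurable.lintegral_prod_right (stronglyMeasurable_pointKernel a hf x).enorm

lemma lintegral_absKernel_lt_top {p : ℝ≥0∞} (hp1 : 1 ≤ p) (hp : p < ((m + 2 : ℕ) : ℝ≥0∞))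
    {f : Euc (m + 2) → 𝕜} (hfm : StronglyMeasurable f) (hf : MemLp f p volume) {a : ℝ} (ha : 0 < a)
    (x : Euc (m + 2)) : ∫⁻ ζ, absKernel a f x ζ ∂(dirMeasure (m + 2)) < ∞ := by
  rw [dirMeasure_eq_map, lintegral_map (measurable_absKernel a hfm x) (measurable_dirOfUnit _)]
  exact lintegral_sphere_pointKernel_lt_top hp1 hp hfm hf ha x

lemma ae_absKernel_lt_top {p : ℝ≥0∞} (hp1 : 1 ≤ p) (hp : p < ((m + 2 : ℕ) : ℝ≥0∞))
    {f : Euc (m + 2) → 𝕜} (hf : MemLp f p volume) {a : ℝ} (ha : 0 < a) (x : Euc (m + 2)) :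
    ∀ᵐ ζ ∂(dirMeasure (m + 2)), absKernel a f x ζ < ∞ := by
  obtain ⟨g, hg, hfg⟩ := hf.1
  rw [absKernel_congr_ae a hfg]
  exact ae_lt_top (measurable_absKernel a hg x)
    (lintegral_absKernel_lt_top hp1 hp hg ((memLp_congr_ae hfg).1 hf) ha x).ne

/-- Since `w = 1` on `[0, 1]`, the kernel with centre `0` and scale `N + 1` equals `f` on every line
at distance at most `N` from the origin. Its absolute integrability for all natural `N` therefore
covers almost every line. -/
lemma almostEveryLine_xrayDefinedAt {p : ℝ≥0∞} (hp1 : 1 ≤ p) (hp : p < ((m + 2 : ℕ) : ℝ≥0∞))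
    {f : Euc (m + 2) → 𝕜} (hf : MemLp f p volume) : AlmostEveryLine (XrayDefinedAt f) := by
  have h : ∀ᵐ ζ ∂(dirMeasure (m + 2)), ∀ N : ℕ, absKernel ((N : ℝ) + 1) f 0 ζ < ∞ :=
    ae_all_iff.2 fun N => ae_absKernel_lt_top hp1 hp hf (by positivity) 0
  filter_upwards [h] with ζ hζ
  have hmeas : ∀ᵐ u : (ζ.1ᗮ : Submodule ℝ (Euc (m + 2))), AEStronglyMeasurable
      (fun x' : ζ.1 => f ((x' : Euc (m + 2)) + (u : Euc (m + 2)))) volume := by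
    have h1 := hf.1.comp_quasiMeasurePreserving (measurePreserving_orthoSplit ζ.1).quasiMeasurePreserving
    rw [Measure.volume_eq_prod] at h1
    filter_upwards [h1.prodMk_left] with u hu
    simpa only [Function.comp_apply, orthoSplit_apply] using hu
  have hfin : ∀ᵐ u : (ζ.1ᗮ : Submodule ℝ (Euc (m + 2))), ∀ N : ℕ,
      ∫⁻ x' : ζ.1, ‖pointKernel ((N : ℝ) + 1) f 0 ζ ((x' : Euc (m + 2)) + u)‖ₑ < ∞ := by
    refine ae_all_iff.2 fun N => ?_
    have hN := hζ N
    have hm := (aestronglyMeasurable_pointKernel ((N : ℝ) + 1) hf.1 0 ζ).enorm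
    rw [absKernel, lintegral_orthoSplit ζ.1 hm] at hN
    refine ae_lt_top' ?_ hN.ne
    have h1 := hm.comp_quasiMeasurePreserving
      (measurePreserving_orthoSplit ζ.1).quasiMeasurePreserving
    rw [Measure.volume_eq_prod] at h1
    have h2 := h1.lintegral_prod_right'
    simpa only [Function.comp_apply, orthoSplit_apply] using h2
  filter_upwards [hmeas, hfin] with u hu1 hu2
  refine ⟨hu1, ?_⟩
  obtain ⟨N, hN⟩ := exists_nat_ge ‖u‖
  refine lt_of_eq_of_lt (lintegral_congr fun x' => ?_) (hu2 N)
  have hle : perpDist ζ (((N : ℝ) + 1)⁻¹ • (0 - (u : Euc (m + 2)))) ≤ 1 := by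
    rw [perpDist]
    refine (Submodule.norm_starProjection_apply_le _ _).trans ?_
    rw [norm_smul, zero_sub, norm_neg, norm_inv, Real.norm_of_nonneg (by positivity),
      inv_mul_le_iff₀ (by positivity), mul_one]
    have : ‖(u : Euc (m + 2))‖ = ‖u‖ := rfl
    linarith
  rw [pointKernel, perpDist_smul_sub_add ζ _ _ _ x'.2, xrayW_of_le_one _ hle, one_smul]

lemma integrable_pointKernel {f : Euc (m + 2) → 𝕜} (hf : AEStronglyMeasurable f volume) {a : ℝ}
    {x : Euc (m + 2)} {ζ : LineDir (m + 2)} (h : absKernel a f x ζ < ∞) :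
    Integrable (pointKernel a f x ζ) volume :=
  ⟨aestronglyMeasurable_pointKernel a hf x ζ, h⟩

lemma integrable_waveletIntegrand {f : Euc (m + 2) → 𝕜} (hf : AEStronglyMeasurable f volume)
    {a : ℝ} (ha : 0 < a) {x : Euc (m + 2)} {ζ : LineDir (m + 2)} (h : absKernel a f x ζ < ∞) :
    Integrable (fun u : (ζ.1ᗮ : Submodule ℝ (Euc (m + 2))) =>
      waveletIntegrand (xrayW (m + 2)) a (xray f) x ⟨ζ, u⟩) volume ∧
    ∫ u : (ζ.1ᗮ : Submodule ℝ (Euc (m + 2))),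
      waveletIntegrand (xrayW (m + 2)) a (xray f) x ⟨ζ, u⟩ = ∫ y, pointKernel a f x ζ y := by
  have hi := (measurePreserving_orthoSplit ζ.1).integrable_comp_of_integrable
    (integrable_pointKernel hf h)
  rw [Measure.volume_eq_prod] at hi
  have h1 := hi.integral_prod_left
  have h2 := integral_prod _ hi
  simp only [Function.comp_apply, orthoSplit_apply] at h1 h2
  simp only [waveletIntegrand_eq f ha]
  refine ⟨h1, ?_⟩
  rw [← h2, ← (measurePreserving_orthoSplit ζ.1).integral_comp (orthoSplit ζ.1).measurableEmbedding,
    Measure.volume_eq_prod]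
  simp only [orthoSplit_apply]

lemma lintegral_enorm_waveletIntegrand_le {f : Euc (m + 2) → 𝕜} (hf : AEStronglyMeasurable f volume)
    {a : ℝ} (ha : 0 < a) (x : Euc (m + 2)) (ζ : LineDir (m + 2)) :
    ∫⁻ u : (ζ.1ᗮ : Submodule ℝ (Euc (m + 2))),
      ‖waveletIntegrand (xrayW (m + 2)) a (xray f) x ⟨ζ, u⟩‖ₑ ≤ absKernel a f x ζ := by
  rw [absKernel, lintegral_orthoSplit ζ.1 (aestronglyMeasurable_pointKernel a hf x ζ).enorm]
  refine lintegral_mono fun u => ?_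
  rw [waveletIntegrand_eq f ha]
  exact enorm_integral_le_lintegral_enorm _

/-- The domain `θᗮ` varies with `θ`, which obstructs measurability in `θ`. The integrand extends to
all of space as a function constant along `θ`; the cutoff `0 ≤ ⟨θ, y⟩ ≤ 1` has mass one along `θ`,
so the integral is unchanged and its domain is now fixed. -/
lemma lintegral_waveletIntegrand_dirOfUnit {f : Euc (m + 2) → 𝕜} (hf : StronglyMeasurable f)
    {a : ℝ} (ha : 0 < a) (x : Euc (m + 2)) (θ : Metric.sphere (0 : Euc (m + 2)) 1) :
    ∫⁻ u : ((dirOfUnit _ θ).1ᗮ : Submodule ℝ (Euc (m + 2))),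
      ‖waveletIntegrand (xrayW (m + 2)) a (xray f) x ⟨dirOfUnit _ θ, u⟩‖ₑ =
    ∫⁻ y, (Icc (0 : ℝ) 1).indicator 1 (inner ℝ (θ : Euc (m + 2)) y) *
      ‖xrayW (m + 2) (√(‖a⁻¹ • (x - y)‖ ^ 2 - inner ℝ (θ : Euc (m + 2)) (a⁻¹ • (x - y)) ^ 2)) •
        ∫ t : ℝ, f (t • (θ : Euc (m + 2)) + y)‖ₑ := by
  have hθ : ‖(θ : Euc (m + 2))‖ = 1 := norm_eq_of_mem_sphere θ
  simp only [← perpDist_dirOfUnit]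
  have hind : Measurable ((Icc (0 : ℝ) 1).indicator (1 : ℝ → ℝ≥0∞)) :=
    measurable_one.indicator measurableSet_Icc
  have hline : StronglyMeasurable fun y : Euc (m + 2) => ∫ t : ℝ, f (t • (θ : Euc (m + 2)) + y) :=
    StronglyMeasurable.integral_prod_right (f := fun y (t : ℝ) => f (t • (θ : Euc (m + 2)) + y))
      (hf.comp_measurable (g := fun q : Euc (m + 2) × ℝ => q.2 • (θ : Euc (m + 2)) + q.1)
        (by fun_prop))
  have hw : Measurable fun y => xrayW (m + 2) (perpDist (dirOfUnit _ θ) (a⁻¹ • (x - y))) :=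
    (measurable_xrayW m).comp ((measurable_perpDist _).comp (by fun_prop))
  rw [lintegral_orthoSplit (dirOfUnit _ θ).1 (Measurable.aemeasurable ?_)]
  · refine lintegral_congr fun u => ?_
    have hval : ∀ t : ℝ, inner ℝ (θ : Euc (m + 2)) (t • (θ : Euc (m + 2)) + (u : Euc (m + 2))) = t := by
      intro t
      have hu : inner ℝ (θ : Euc (m + 2)) (u : Euc (m + 2)) = 0 :=
        Submodule.inner_right_of_mem_orthogonal (Submodule.mem_span_singleton_self _) u.2
      rw [inner_add_right, hu, add_zero, real_inner_smul_right, real_inner_self_eq_norm_sq, hθ]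
      norm_num
    have hperp : ∀ t : ℝ, perpDist (dirOfUnit _ θ) (a⁻¹ • (x - (t • (θ : Euc (m + 2)) + u))) =
        perpDist (dirOfUnit _ θ) (a⁻¹ • (x - u)) := fun t =>
      perpDist_smul_sub_add _ _ x u
        (Submodule.smul_mem _ t (Submodule.mem_span_singleton_self (θ : Euc (m + 2))))
    have hshift : ∀ s : ℝ, ∫ t : ℝ, f (t • (θ : Euc (m + 2)) + (s • (θ : Euc (m + 2)) + u)) =
        ∫ t : ℝ, f (t • (θ : Euc (m + 2)) + u) := by
      intro s
      rw [← integral_add_right_eq_self (fun t : ℝ => f (t • (θ : Euc (m + 2)) + u)) s]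
      simp only [add_smul, add_assoc]
    refine Eq.trans ?_ (lintegral_span_unit θ _).symm
    simp only [hval, hperp, hshift]
    rw [lintegral_mul_const' _ _ enorm_ne_top, lintegral_indicator_one measurableSet_Icc,
      Real.volume_Icc, sub_zero, ENNReal.ofReal_one, one_mul,
      waveletIntegrand_eq_smul f ha, xray_dirOfUnit]
  · exact (hind.comp (by fun_prop)).mul (hw.stronglyMeasurable.smul hline).enorm

lemma measurable_lintegral_waveletIntegrand {f : Euc (m + 2) → 𝕜} (hf : StronglyMeasurable f)
    {a : ℝ} (ha : 0 < a) (x : Euc (m + 2)) :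
    Measurable fun ζ : LineDir (m + 2) => ∫⁻ u : (ζ.1ᗮ : Submodule ℝ (Euc (m + 2))),
      ‖waveletIntegrand (xrayW (m + 2)) a (xray f) x ⟨ζ, u⟩‖ₑ := by
  refine measurable_of_comp_dirOfUnit ?_
  simp only [lintegral_waveletIntegrand_dirOfUnit hf ha]
  have hind : Measurable ((Icc (0 : ℝ) 1).indicator (1 : ℝ → ℝ≥0∞)) :=
    measurable_one.indicator measurableSet_Icc
  have hline : StronglyMeasurable fun q : Metric.sphere (0 : Euc (m + 2)) 1 × Euc (m + 2) =>
      ∫ t : ℝ, f (t • (q.1 : Euc (m + 2)) + q.2) :=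
    StronglyMeasurable.integral_prod_right
      (f := fun (q : Metric.sphere (0 : Euc (m + 2)) 1 × Euc (m + 2)) (t : ℝ) =>
        f (t • (q.1 : Euc (m + 2)) + q.2))
      (hf.comp_measurable
        (g := fun q : (Metric.sphere (0 : Euc (m + 2)) 1 × Euc (m + 2)) × ℝ =>
          q.2 • (q.1.1 : Euc (m + 2)) + q.1.2) (by fun_prop))
  refine Measurable.lintegral_prod_right (f := fun (θ : Metric.sphere (0 : Euc (m + 2)) 1) y =>
    (Icc (0 : ℝ) 1).indicator 1 (inner ℝ (θ : Euc (m + 2)) y) *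
      ‖xrayW (m + 2) (√(‖a⁻¹ • (x - y)‖ ^ 2 - inner ℝ (θ : Euc (m + 2)) (a⁻¹ • (x - y)) ^ 2)) •
        ∫ t : ℝ, f (t • (θ : Euc (m + 2)) + y)‖ₑ) ?_
  exact (hind.comp (by fun_prop)).mul
    ((measurable_xrayW_perp a x).stronglyMeasurable.smul hline).enorm

lemma lineIntegrable_waveletIntegrand {p : ℝ≥0∞} (hp1 : 1 ≤ p) (hp : p < ((m + 2 : ℕ) : ℝ≥0∞))
    {f : Euc (m + 2) → 𝕜} (hf : MemLp f p volume) {a : ℝ} (ha : 0 < a) (x : Euc (m + 2)) :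
    LineIntegrable (waveletIntegrand (xrayW (m + 2)) a (xray f) x) := by
  obtain ⟨g, hg, hfg⟩ := hf.1
  have hgL : MemLp g p volume := (memLp_congr_ae hfg).1 hf
  have hae := ae_absKernel_lt_top hp1 hp hf ha x
  have hint : ∀ᵐ ζ ∂(dirMeasure (m + 2)), Integrable
      (fun u : (ζ.1ᗮ : Submodule ℝ (Euc (m + 2))) =>
        waveletIntegrand (xrayW (m + 2)) a (xray f) x ⟨ζ, u⟩) volume := by
    filter_upwards [hae] with ζ hζ using (integrable_waveletIntegrand hf.1 ha hζ).1
  refine ⟨hint, ?_⟩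
  have hfin : ∫⁻ ζ : LineDir (m + 2), (∫⁻ u : (ζ.1ᗮ : Submodule ℝ (Euc (m + 2))),
      ‖waveletIntegrand (xrayW (m + 2)) a (xray g) x ⟨ζ, u⟩‖ₑ) ∂(dirMeasure (m + 2)) ≠ ∞ :=
    ((lintegral_mono fun ζ => lintegral_enorm_waveletIntegrand_le
      hg.aestronglyMeasurable ha x ζ).trans_lt (lintegral_absKernel_lt_top hp1 hp hg hgL ha x)).ne
  refine (integrable_toReal_of_lintegral_ne_top
    (measurable_lintegral_waveletIntegrand hg ha x).aemeasurable hfin).congr ?_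
  filter_upwards [hint] with ζ hζ
  rw [integral_norm_eq_lintegral_enorm hζ.1]
  congr 1
  refine lintegral_congr_ae ?_
  filter_upwards [ae_xray_eq_of_ae_eq hfg ζ] with u hu
  simp only [waveletIntegrand, hu]

/-- Fubini brings the direction average inside, where the Abel equation evaluates it as `ψ`. -/
lemma lineIntegral_waveletIntegrand {p : ℝ≥0∞} (hp1 : 1 ≤ p) (hp : p < ((m + 2 : ℕ) : ℝ≥0∞))
    {f : Euc (m + 2) → 𝕜} (hf : MemLp f p volume) {a : ℝ} (ha : 0 < a) (x : Euc (m + 2)) :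
    lineIntegral (waveletIntegrand (xrayW (m + 2)) a (xray f) x) =
      ∫ y, nievergeltPsi ‖a⁻¹ • (x - y)‖ • f y := by
  borelize 𝕜
  obtain ⟨g, hg, hfg⟩ := hf.1
  have hgL : MemLp g p volume := (memLp_congr_ae hfg).1 hf
  have hsm := stronglyMeasurable_pointKernel a hg x
  have hΨ : Measurable fun ζ : LineDir (m + 2) => ∫ y, pointKernel a g x ζ y :=
    measurable_of_comp_dirOfUnit hsm.integral_prod_right.measurable
  have hprod : Integrable (Function.uncurry fun (θ : Metric.sphere (0 : Euc (m + 2)) 1) y =>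
      pointKernel a g x (dirOfUnit _ θ) y) ((sphereProb (Euc (m + 2))).prod volume) := by
    refine ⟨hsm.aestronglyMeasurable, ?_⟩
    rw [HasFiniteIntegral, lintegral_prod _ hsm.enorm.aemeasurable]
    exact lintegral_sphere_pointKernel_lt_top hp1 hp hg hgL ha x
  calc
    _ = ∫ ζ, (∫ y, pointKernel a g x ζ y) ∂(dirMeasure (m + 2)) := by
      refine integral_congr_ae ?_
      filter_upwards [ae_absKernel_lt_top hp1 hp hf ha x] with ζ hζ
      rw [(integrable_waveletIntegrand hf.1 ha hζ).2]
      exact integral_congr_ae (pointKernel_congr_ae a hfg x ζ)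
    _ = ∫ θ, (∫ y, pointKernel a g x (dirOfUnit _ θ) y) ∂(sphereProb (Euc (m + 2))) := by
      rw [dirMeasure_eq_map, integral_map (measurable_dirOfUnit _).aemeasurable
        hΨ.stronglyMeasurable.aestronglyMeasurable]
    _ = ∫ y, (∫ θ, pointKernel a g x (dirOfUnit _ θ) y ∂(sphereProb (Euc (m + 2)))) :=
      integral_integral_swap hprod
    _ = _ := by
      refine integral_congr_ae ?_
      -- The law of the projected length is available only for `z ≠ 0`, so the null point `y = x` is
      -- discarded.
      filter_upwards [compl_mem_ae_iff.2 (measure_singleton x), hfg] with y hy hfy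
      have hxy : x - y ≠ 0 := sub_ne_zero.2 fun h => hy h.symm
      have hz : a⁻¹ • (x - y) ≠ 0 := smul_ne_zero (inv_ne_zero ha.ne') hxy
      simp only [pointKernel_dirOfUnit]
      rw [integral_smul_const, integral_sphereProb_xrayW (by simp) hz, hfy]

lemma waveletTransform_xray {p : ℝ≥0∞} (hp1 : 1 ≤ p) (hp : p < ((m + 2 : ℕ) : ℝ≥0∞))
    {f : Euc (m + 2) → 𝕜} (hf : MemLp f p volume) {a : ℝ} (ha : 0 < a) (x : Euc (m + 2)) :
    waveletTransform (xrayW (m + 2)) a (xray f) x = ballMean a f x := by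
  rw [waveletTransform, lineIntegral_waveletIntegrand hp1 hp hf ha, ballMean_eq_integral_div ha]

end Inversion

/-- (i) the case of lines in any dimension `n ≥ 2`; (ii) the case of `k`-planes, `1 < k < n`,
where not even an almost everywhere solution exists. -/
theorem theoremA {𝕜 : Type*} [RCLike 𝕜] :
    (∀ n : ℕ, 2 ≤ n →
      LocallyIntegrableOn (xrayW n) (Ici 0) volume ∧
      (∀ r : ℝ, 0 < r → AbelEquationAt n 1 nievergeltPsi (xrayW n) r) ∧
      (n = 2 → ∀ r : ℝ, 0 ≤ r → xrayW n r = nievergeltW r) ∧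
      (∀ p : ℝ≥0∞, 1 ≤ p → p < (n : ℝ≥0∞) → ∀ f : Euc n → 𝕜, MemLp f p volume →
        AlmostEveryLine (XrayDefinedAt f) ∧
        (∀ a : ℝ, 0 < a → ∀ x : Euc n,
          LineIntegrable (waveletIntegrand (xrayW n) a (xray f) x) ∧
          waveletTransform (xrayW n) a (xray f) x =
            ∫ y : Euc n, nievergeltPsi ‖y‖ • f (x - a • y)) ∧
        (∀ a : ℝ, 0 < a → MemLp (waveletTransform (xrayW n) a (xray f)) p volume) ∧
        Tendsto
          (fun a : ℝ => eLpNorm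
            (fun x => waveletTransform (xrayW n) a (xray f) x - nievergeltLambda n • f x)
            p volume)
          (𝓝[>] 0) (𝓝 0) ∧
        (∀ᵐ x : Euc n,
          Tendsto (fun a : ℝ => waveletTransform (xrayW n) a (xray f) x)
            (𝓝[>] 0) (𝓝 (nievergeltLambda n • f x))) ∧
        (Continuous f → Tendsto f (cocompact (Euc n)) (𝓝 0) →
          TendstoUniformly (fun (a : ℝ) (x : Euc n) => waveletTransform (xrayW n) a (xray f) x)
            (fun x => nievergeltLambda n • f x) (𝓝[>] 0)))) ∧
    (∀ n k : ℕ, 1 < k → k < n →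
      ¬ ∃ w : ℝ → ℝ, ∀ᵐ r ∂(volume.restrict (Ioi (0 : ℝ))),
        AbelEquationAt n k nievergeltPsi w r) := by
  refine ⟨fun n hn => ?_, fun n k hk hkn => not_exists_abel_solution hk hkn⟩
  obtain ⟨m, rfl⟩ : ∃ m, n = m + 2 := ⟨n - 2, by omega⟩
  refine ⟨locallyIntegrableOn_xrayW m, fun r hr => abelEquationAt_xrayW m hr, ?_, ?_⟩
  · intro hm r _
    obtain rfl : m = 0 := by omega
    exact xrayW_two
  intro p hp1 hp f hf
  have hpt : p ≠ ∞ := (hp.trans_le le_top).ne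
  have heq : ∀ a : ℝ, 0 < a → waveletTransform (xrayW (m + 2)) a (xray f) = ballMean a f :=
    fun a ha => funext fun x => waveletTransform_xray hp1 hp hf ha x
  have hpos : ∀ᶠ a : ℝ in 𝓝[>] 0, 0 < a := self_mem_nhdsWithin
  refine ⟨almostEveryLine_xrayDefinedAt hp1 hp hf, fun a ha x =>
    ⟨lineIntegrable_waveletIntegrand hp1 hp hf ha x, waveletTransform_xray hp1 hp hf ha x⟩,
    fun a ha => ?_, ?_, ?_, fun hc h0 => ?_⟩
  · rw [heq a ha]
    exact memLp_ballMean hp1 hpt hf ha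
  · refine (tendsto_eLpNorm_ballMean_sub hp1 hpt hf).congr' ?_
    filter_upwards [hpos] with a ha
    rw [heq a ha]
  · filter_upwards [ae_tendsto_ballMean hp1 hf] with x hx
    refine hx.congr' ?_
    filter_upwards [hpos] with a ha
    rw [heq a ha]
  · intro U hU
    filter_upwards [tendstoUniformly_ballMean hp1 hf hc h0 U hU, hpos] with a h1 ha x
    rw [heq a ha]
    exact h1 x
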